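/- Let $d\in\mathbb N$, let $\gamma$ be the standard Gaussian measure on $\mathbb R^d$, $\mathrm d\gamma(x)=(2\pi)^{-d/2}e^{-|x|^2/2}\,\mathrm dx$, and let $L$ be the Ornstein--Uhlenbeck operator on the complex space $L^2(\mathbb R^d,\gamma)$, i.e. the closure of the operator $f\mapsto -\Delta f+x\cdot\nabla f$ with domain $C_{\rm c}^2(\mathbb R^d)$. For $z\in\mathbb C$ with $\operatorname{Re} z>0$, let $\exp(-zL)$ be the bounded operator on $L^2(\mathbb R^d,\gamma)$ that is the value at time $1$ of the $C_0$-semigroup generated by $-zL$. **Theorem.** Let $1<p\le q<\infty$, and let $z\in\mathbb C$ satisfy $\operatorname{Re} z>0$, $$|e^{-z}|^2<\frac pq$$ and $$(q-1)|e^{-z}|^4+(2-p-q)(\operatorname{Re}e^{-z})^2-(2-p-q+pq)(\operatorname{Im}e^{-z})^2+p-1>0.$$ Then the operator $\exp(-zL)$ exists, is unique, and maps $L^p(\mathbb R^d,\gamma)$ boundedly into $L^q(\mathbb R^d,\gamma)$: there is a bounded linear operator $T\colon L^p(\mathbb R^d,\gamma)\to L^q(\mathbb R^d,\gamma)$ such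 that $Tf=\exp(-zL)f$ $\gamma$-almost everywhere for every $f\in L^2(\mathbb R^d,\gamma)\cap L^p(\mathbb R^d,\gamma)$. -/

import Mathlib

open MeasureTheory Filter Topology
open scoped ENNReal

noncomputable section

/-- The standard Gaussian measure on `ℝᵈ`, with density `(2π)^{-d/2} exp(-|x|²/2)` with respect to
the Lebesgue measure. -/
def gaussianRd (d : ℕ) : Measure (EuclideanSpace ℝ (Fin d)) :=
  volume.withDensity fun x =>
    ENNReal.ofReal ((2 * Real.pi) ^ (-(d : ℝ) / 2) * Real.exp (-‖x‖ ^ 2 / 2))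

/-- The complex Hilbert space `L²(ℝᵈ, γ)`. -/
abbrev GaussL2 (d : ℕ) : Type := Lp ℂ 2 (gaussianRd d)

/-- The differential expression `-Δ f(x) + x · ∇f(x)`. -/
def ouExpr {d : ℕ} (f : EuclideanSpace ℝ (Fin d) → ℂ) (x : EuclideanSpace ℝ (Fin d)) : ℂ :=
  -Laplacian.laplacian f x + fderiv ℝ f x x

lemma ouExpr_add {d : ℕ} {f g : EuclideanSpace ℝ (Fin d) → ℂ}
    (hf : ContDiff ℝ 2 f) (hg : ContDiff ℝ 2 g) :
    ouExpr (f + g) = ouExpr f + ouExpr g := by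
  funext x
  have h := (hf.contDiffAt (x := x)).laplacian_add hg.contDiffAt
  have h' := fderiv_add ((hf.differentiable (by norm_num)) x) ((hg.differentiable (by norm_num)) x)
  simp only [ouExpr, Pi.add_apply, h, h', add_apply]
  ring

lemma ouExpr_smul {d : ℕ} (c : ℂ) {f : EuclideanSpace ℝ (Fin d) → ℂ} (hf : ContDiff ℝ 2 f) :
    ouExpr (c • f) = c • ouExpr f := by
  funext x
  have h := InnerProductSpace.laplacian_smul c (hf.contDiffAt (x := x))
  have h' := fderiv_const_smul ((hf.differentiable (by norm_num)) x) c
  simp only [ouExpr, Pi.smul_apply, h, h', smul_apply, smul_eq_mul]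
  ring

/-- The graph in `L²(γ) × L²(γ)` of `f ↦ -Δ f + x · ∇f` on the test functions `f ∈ C_c²(ℝᵈ)`. -/
def ouTestGraph (d : ℕ) : Submodule ℂ (GaussL2 d × GaussL2 d) where
  carrier := {u | ∃ f : EuclideanSpace ℝ (Fin d) → ℂ, ContDiff ℝ 2 f ∧ HasCompactSupport f ∧
    u.1 =ᵐ[gaussianRd d] f ∧ u.2 =ᵐ[gaussianRd d] ouExpr f}
  zero_mem' := by
    refine ⟨0, contDiff_const, HasCompactSupport.zero, Lp.coeFn_zero _ _ _, ?_⟩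
    have h : ouExpr (0 : EuclideanSpace ℝ (Fin d) → ℂ) = 0 := by
      simpa using ouExpr_smul (0 : ℂ) (contDiff_const (c := (0 : ℂ)) (n := 2) (𝕜 := ℝ)
        (E := EuclideanSpace ℝ (Fin d)))
    rw [h]
    exact Lp.coeFn_zero _ _ _
  add_mem' := by
    rintro u v ⟨f, hf, hfc, hu1, hu2⟩ ⟨g, hg, hgc, hv1, hv2⟩
    refine ⟨f + g, hf.add hg, hfc.add hgc, ?_, ?_⟩
    · exact (Lp.coeFn_add _ _).trans (hu1.add hv1)
    · rw [ouExpr_add hf hg]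
      exact (Lp.coeFn_add _ _).trans (hu2.add hv2)
  smul_mem' := by
    rintro c u ⟨f, hf, hfc, hu1, hu2⟩
    refine ⟨c • f, contDiff_const.smul hf, hfc.smul_left (f := fun _ => c), ?_, ?_⟩
    · exact (Lp.coeFn_smul _ _).trans (hu1.const_smul c)
    · rw [ouExpr_smul c hf]
      exact (Lp.coeFn_smul _ _).trans (hu2.const_smul c)

/-- The Ornstein--Uhlenbeck operator `f ↦ -Δ f + x · ∇f` on `L²(γ)`, with domain `C_c²(ℝᵈ)`. -/
def ouTest (d : ℕ) : GaussL2 d →ₗ.[ℂ] GaussL2 d := (ouTestGraph d).toLinearPMap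

/-- The Ornstein--Uhlenbeck operator `L` on `L²(γ)`: the closure of `-Δ + x · ∇` on `C_c²(ℝᵈ)`. -/
def ouOperator (d : ℕ) : GaussL2 d →ₗ.[ℂ] GaussL2 d := (ouTest d).closure

lemma volume_ac_gaussianRd (d : ℕ) : volume ≪ gaussianRd d := by
  refine withDensity_absolutelyContinuous' (by fun_prop) (ae_of_all _ fun x => ?_)
  simp only [ne_eq, ENNReal.ofReal_eq_zero, not_le]
  positivity

/-- The graph relation above is single valued, so `ouTest` really has that graph. -/
lemma ouTest_graph (d : ℕ) : (ouTest d).graph = ouTestGraph d := by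
  refine Submodule.toLinearPMap_graph_eq _ ?_
  rintro u ⟨f, hf, -, hu1, hu2⟩ h0
  have h1 : f =ᵐ[volume] (0 : EuclideanSpace ℝ (Fin d) → ℂ) := by
    refine (volume_ac_gaussianRd d).ae_le ?_
    have h2 := Lp.coeFn_zero ℂ 2 (gaussianRd d)
    rw [← h0] at h2
    exact hu1.symm.trans h2
  have h3 : f = (0 : ℂ) • f := by
    rw [zero_smul]
    exact (Continuous.ae_eq_iff_eq _ hf.continuous continuous_const).1 h1
  have h4 : ouExpr f = 0 := by
    rw [h3, ouExpr_smul 0 hf, zero_smul]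
  rw [h4] at hu2
  exact Lp.ext (hu2.trans (Lp.coeFn_zero ℂ 2 (gaussianRd d)).symm)

/-- `S` is the strongly continuous (`C₀`) semigroup on `H` generated by the (unbounded) operator
`A`. The values `S t` with `t < 0` are irrelevant. -/
structure IsSemigroupGeneratedBy {H : Type*} [NormedAddCommGroup H] [NormedSpace ℂ H]
    (S : ℝ → H →L[ℂ] H) (A : H →ₗ.[ℂ] H) : Prop where
  map_zero : S 0 = ContinuousLinearMap.id ℂ H
  map_add : ∀ s t : ℝ, 0 ≤ s → 0 ≤ t → S (s + t) = (S s).comp (S t)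
  strong_continuity : ∀ u : H, Tendsto (fun t : ℝ => S t u) (𝓝[>] 0) (𝓝 u)
  generator : ∀ u w : H,
    (u, w) ∈ A.graph ↔ Tendsto (fun t : ℝ => t⁻¹ • (S t u - u)) (𝓝[>] 0) (𝓝 w)

/-- `V = exp(-zL)` on `L²(γ)`: the value at time `1` of the `C₀`-semigroup generated by `-zL`. -/
def IsExpNegOU {d : ℕ} (z : ℂ) (V : GaussL2 d →L[ℂ] GaussL2 d) : Prop :=
  ∃ S : ℝ → GaussL2 d →L[ℂ] GaussL2 d,
    IsSemigroupGeneratedBy S ((-z) • ouOperator d) ∧ V = S 1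

end

/-! Write `w = exp(-z)`, so `|w| < 1`. The argument identifies `exp(-zL)` with an integral operator
whose kernel is Gaussian, and bounds that kernel by a product `A(x) B(y)` with `A ∈ L^q(γ)` and `B ∈
L^{p'}(γ)`; Hölder's inequality then gives boundedness from `L^p(γ)` to `L^q(γ)`.

The spectral side diagonalises `L`. The ridge functions `Hₙ(⟨e, x⟩)`, with `Hₙ` a Hermite polynomial
and `e` a unit vector, satisfy the eigenvalue equation with eigenvalue `n`. Using all directions `e`
replaces multi-index Hermite polynomials. They are total because the powers of `⟨e, x⟩` generate the
characters, and cut-off places them in the domain of the closure. Hence `L` is the maximal diagonal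
operator in a Hilbert basis of eigenvectors (`mem_closure_ouTestGraph_iff`, `graph_ouOperator`).
This gives existence of `exp(-zL)` by multipliers, and uniqueness because a semigroup is determined
on eigenvectors of its generator.

The kernel is found by testing on the exponentials `gaussExp c η`. Their pairing with a ridge
function of degree `n` is homogeneous of degree `n` in `c`, so `exp(-zL)` replaces `c` by `w c`. A
Gaussian integral shows that the Mehler kernel does the same (`integral_mehler_mul_gaussExp`), and
the exponentials with `c = i` span a dense subspace of `L²(γ)`.

For the bound, the real part of the exponent of the kernel is compared with the critical exponents
`|x|²/(2q)` and `(p-1)|y|²/(2p)`. Cauchy–Schwarz reduces this to positivity of a binary quadratic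
form (`mehler_form_pos`). The quartic hypothesis on `w` says exactly that its determinant is
positive; `|w|² < p/q` excludes the negative definite case. Positive definiteness is an open
condition, which leaves the room `ε` needed for integrability. -/

noncomputable section

/-! ### Strongly continuous semigroups -/

section Semigroup

variable {H : Type*} [NormedAddCommGroup H] [NormedSpace ℂ H]

/-- A strongly continuous semigroup is bounded near the origin. -/
lemma IsSemigroupGeneratedBy.exists_bound [CompleteSpace H] {S : ℝ → H →L[ℂ] H} {A : H →ₗ.[ℂ] H}
    (hS : IsSemigroupGeneratedBy S A) :
    ∃ δ > 0, ∃ C : ℝ, ∀ t, 0 < t → t < δ → ‖S t‖ ≤ C := by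
  by_contra! hcon
  have h1 : ∀ n : ℕ, ∃ t : ℝ, 0 < t ∧ t < 1 / ((n : ℝ) + 1) ∧ (n : ℝ) < ‖S t‖ := fun n =>
    hcon (1 / ((n : ℝ) + 1)) (by positivity) n
  choose t ht0 ht1 ht2 using h1
  have htend : Tendsto t atTop (𝓝[>] 0) := by
    refine tendsto_nhdsWithin_iff.2 ⟨?_, Eventually.of_forall ht0⟩
    exact squeeze_zero (fun n => (ht0 n).le) (fun n => (ht1 n).le)
      tendsto_one_div_add_atTop_nhds_zero_nat
  -- Each orbit converges along `t n → 0`, hence is bounded there; uniform boundedness contradicts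
  -- the growth of `‖S (t n)‖`.
  obtain ⟨C, hC⟩ := banach_steinhaus (g := fun n => S (t n)) fun u => by
    obtain ⟨C, hC⟩ := ((hS.strong_continuity u).comp htend).norm.bddAbove_range
    exact ⟨C, fun n => hC ⟨n, rfl⟩⟩
  obtain ⟨n, hn⟩ := exists_nat_gt C
  exact absurd (hC n) (not_le.2 (hn.trans (ht2 n)))

/-- The orbits of a strongly continuous semigroup are continuous. -/
lemma IsSemigroupGeneratedBy.continuousOn [CompleteSpace H] {S : ℝ → H →L[ℂ] H} {A : H →ₗ.[ℂ] H}
    (hS : IsSemigroupGeneratedBy S A) (u : H) : ContinuousOn (fun t => S t u) (Set.Ici 0) := by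
  obtain ⟨δ, hδ, C, hC⟩ := hS.exists_bound
  intro t ht
  have ht : 0 ≤ t := ht
  have hshift : Tendsto (fun s => s - t) (𝓝[>] t) (𝓝[>] 0) := by
    refine tendsto_nhdsWithin_iff.2 ⟨?_, ?_⟩
    · have : Tendsto (fun s => s - t) (𝓝 t) (𝓝 (t - t)) := (continuous_sub_right t).tendsto t
      rw [sub_self] at this
      exact this.mono_left nhdsWithin_le_nhds
    · filter_upwards [self_mem_nhdsWithin] with s hs
      exact sub_pos.2 (by simpa using hs)
  have hright : Tendsto (fun s => S s u) (𝓝[>] t) (𝓝 (S t u)) := by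
    have h1 := ((S t).continuous.tendsto u).comp ((hS.strong_continuity u).comp hshift)
    refine h1.congr' ?_
    filter_upwards [self_mem_nhdsWithin] with s hs
    have h2 := hS.map_add t (s - t) ht (sub_pos.2 (by simpa using hs)).le
    rw [add_sub_cancel] at h2
    simp [h2]
  rcases ht.eq_or_lt with rfl | htpos
  · rw [ContinuousWithinAt, ← Set.Ioi_insert, nhdsWithin_insert]
    exact tendsto_sup.2 ⟨tendsto_pure_nhds _ _, hright⟩
  have hshift' : Tendsto (fun s => t - s) (𝓝[<] t) (𝓝[>] 0) := by
    refine tendsto_nhdsWithin_iff.2 ⟨?_, ?_⟩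
    · have : Tendsto (fun s => t - s) (𝓝 t) (𝓝 (t - t)) := (continuous_sub_left t).tendsto t
      rw [sub_self] at this
      exact this.mono_left nhdsWithin_le_nhds
    · filter_upwards [self_mem_nhdsWithin] with s hs
      exact sub_pos.2 (by simpa using hs)
  -- For `s` in `(t - η, t)`, factoring `S s` through `S (t - η)` leaves a time in `(0, η)`, where
  -- the norm is at most `C`. So `‖S s‖` is bounded as `s` increases to `t`.
  set η := min δ t / 2 with hη
  have hη0 : 0 < η := by positivity
  have hηδ : η < δ := by have := min_le_left δ t; linarith [hη0]
  have hηt : η < t := by have := min_le_right δ t; linarith [hη0]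
  have hleft : Tendsto (fun s => S s u) (𝓝[<] t) (𝓝 (S t u)) := by
    rw [tendsto_iff_norm_sub_tendsto_zero]
    have h0 : Tendsto (fun s => ‖S (t - η)‖ * C * ‖S (t - s) u - u‖) (𝓝[<] t) (𝓝 0) := by
      have h1 := ((tendsto_iff_norm_sub_tendsto_zero.1 (hS.strong_continuity u)).comp hshift')
      simpa using h1.const_mul (‖S (t - η)‖ * C)
    refine squeeze_zero' (Eventually.of_forall fun _ => norm_nonneg _) ?_ h0
    filter_upwards [Ioo_mem_nhdsLT (show t - η < t by linarith)] with s hs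
    have h1 : S t = (S s).comp (S (t - s)) := by
      rw [← hS.map_add s (t - s) (by linarith [hs.1]) (by linarith [hs.2]), add_sub_cancel]
    have h2 : S s = (S (t - η)).comp (S (s - (t - η))) := by
      rw [← hS.map_add (t - η) _ (by linarith) (by linarith [hs.1]), add_sub_cancel]
    have h3 : S s u - S t u = - S s (S (t - s) u - u) := by simp [h1]
    rw [h3, norm_neg]
    refine (ContinuousLinearMap.le_opNorm _ _).trans ?_
    gcongr
    rw [h2]
    refine (ContinuousLinearMap.opNorm_comp_le _ _).trans ?_
    gcongr
    exact hC _ (by linarith [hs.1]) (by linarith [hs.2])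
  refine ContinuousAt.continuousWithinAt ?_
  rw [continuousAt_iff_continuous_left'_right']
  exact ⟨hleft, hright⟩

/-- A semigroup acts on eigenvectors of its generator by exponentials of the eigenvalue. -/
lemma IsSemigroupGeneratedBy.apply_eigenvector [CompleteSpace H] {S : ℝ → H →L[ℂ] H}
    {A : H →ₗ.[ℂ] H} (hS : IsSemigroupGeneratedBy S A) {u : H} {μ : ℂ}
    (hu : (u, μ • u) ∈ A.graph) {t : ℝ} (ht : 0 ≤ t) : S t u = Complex.exp (μ * t) • u := by
  have hderiv : ∀ s : ℝ, 0 ≤ s → HasDerivWithinAt (fun s => S s u) (μ • S s u) (Set.Ici s) s := by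
    intro s hs
    rw [← hasDerivWithinAt_Ioi_iff_Ici, hasDerivWithinAt_iff_tendsto_slope' (by simp)]
    have hshift : Tendsto (fun r => r - s) (𝓝[>] s) (𝓝[>] 0) := by
      refine tendsto_nhdsWithin_iff.2 ⟨?_, ?_⟩
      · have : Tendsto (fun r => r - s) (𝓝 s) (𝓝 (s - s)) := (continuous_sub_right s).tendsto s
        rw [sub_self] at this
        exact this.mono_left nhdsWithin_le_nhds
      · filter_upwards [self_mem_nhdsWithin] with r hr
        exact sub_pos.2 (by simpa using hr)
    have h1 := ((S s).continuous.tendsto _).comp (((hS.generator _ _).1 hu).comp hshift)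
    rw [map_smul] at h1
    refine h1.congr' ?_
    filter_upwards [self_mem_nhdsWithin] with r hr
    have h2 := hS.map_add s (r - s) hs (sub_pos.2 (by simpa using hr)).le
    rw [add_sub_cancel] at h2
    have h3 : S s ((r - s)⁻¹ • (S (r - s) u - u)) = (r - s)⁻¹ • S s (S (r - s) u - u) :=
      ((S s).restrictScalars ℝ).map_smul _ _
    simp [h2, slope_def_module, h3]
  have hE : ∀ s : ℝ, HasDerivAt (fun s : ℝ => Complex.exp (-μ * s))
      (Complex.exp (-μ * s) * (-μ)) s := fun s => by
    have := ((hasDerivAt_id (s : ℂ)).const_mul (-μ)).cexp.comp_ofReal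
    simpa using this
  -- The generator supplies right derivatives only; a continuous function whose right derivative
  -- vanishes is still constant.
  have h := constant_of_has_deriv_right_zero (a := 0) (b := t)
    (f := fun s : ℝ => Complex.exp (-μ * s) • S s u) ?_ ?_ t ⟨ht, le_rfl⟩
  · have h0 : Complex.exp (-μ * t) • S t u = u := by simpa [hS.map_zero] using h
    calc S t u = Complex.exp (μ * t) • Complex.exp (-μ * t) • S t u := by
          rw [smul_smul, ← Complex.exp_add]
          simp
      _ = _ := by rw [h0]
  · refine ContinuousOn.smul (Continuous.continuousOn (by fun_prop)) ?_
    exact (hS.continuousOn u).mono Set.Icc_subset_Ici_self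
  · intro s hs
    have h1 := (hE s).hasDerivWithinAt (s := Set.Ici s) |>.smul (hderiv s hs.1)
    refine h1.congr_deriv ?_
    rw [smul_smul, ← add_smul]
    simp

end Semigroup

/-! ### Diagonal semigroups -/

section Diagonal

variable {H ι : Type*} [NormedAddCommGroup H] [InnerProductSpace ℂ H]

lemma HilbertBasis.hasSum_norm_sq (b : HilbertBasis ι ℂ H) (u : H) :
    HasSum (fun i => ‖b.repr u i‖ ^ 2) (‖u‖ ^ 2) := by
  have h := lp.hasSum_norm (p := 2) (by norm_num) (b.repr u)
  simpa using h

/-- Dominated convergence in coordinates. -/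
lemma HilbertBasis.tendsto_of_dominated (b : HilbertBasis ι ℂ H) {α : Type*} {l : Filter α}
    [l.IsCountablyGenerated] {F : α → H} {w : H} {g : ι → ℝ} (hg : Summable fun i => g i ^ 2)
    (hF : ∀ i, Tendsto (fun t => b.repr (F t) i) l (𝓝 (b.repr w i)))
    (hb : ∀ᶠ t in l, ∀ i, ‖b.repr (F t) i - b.repr w i‖ ≤ g i) : Tendsto F l (𝓝 w) := by
  rw [tendsto_iff_norm_sub_tendsto_zero]
  -- By Parseval this sum is `‖F t - w‖²`, so dominated convergence for series applies.
  have h1 : Tendsto (fun t => ∑' i, ‖b.repr (F t - w) i‖ ^ 2) l (𝓝 (∑' _ : ι, (0 : ℝ))) := by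
    refine tendsto_tsum_of_dominated_convergence (bound := fun i => g i ^ 2) hg (fun i => ?_) ?_
    · have := (tendsto_iff_norm_sub_tendsto_zero.1 (hF i)).pow 2
      simpa using this
    · filter_upwards [hb] with t ht i
      have := ht i
      simp only [map_sub, lp.coeFn_sub, Pi.sub_apply, norm_pow, norm_norm]
      gcongr
  have h2 : ∀ t, ∑' i, ‖b.repr (F t - w) i‖ ^ 2 = ‖F t - w‖ ^ 2 := fun t =>
    (b.hasSum_norm_sq _).tsum_eq
  simp only [h2, tsum_zero] at h1
  have := h1.sqrt
  simpa using this

/-- The contraction with matrix `diag m` in a Hilbert basis, for multipliers `m` bounded by `1`. -/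
def HilbertBasis.diag (b : HilbertBasis ι ℂ H) (m : ι → ℂ) (hm : ∀ i, ‖m i‖ ≤ 1) : H →L[ℂ] H :=
  b.repr.symm.toContinuousLinearEquiv.toContinuousLinearMap.comp
    ((LinearMap.mkContinuous (σ := RingHom.id ℂ)
      { toFun := fun f : lp (fun _ : ι => ℂ) 2 => (⟨fun i => m i * f i,
          (lp.memℓp f).mono' fun i => by
            rw [norm_mul]; exact mul_le_of_le_one_left (norm_nonneg _) (hm i)⟩ :
            lp (fun _ : ι => ℂ) 2)
        map_add' := fun f g => Subtype.ext (funext fun i => mul_add (m i) (f i) (g i))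
        map_smul' := fun c f => Subtype.ext (funext fun i => mul_left_comm (m i) c (f i)) } 1
      fun f => by
      rw [one_mul]
      refine lp.norm_mono (by norm_num) fun i => ?_
      simpa using mul_le_of_le_one_left (norm_nonneg _) (hm i)).comp
      b.repr.toContinuousLinearEquiv.toContinuousLinearMap)

@[simp]
lemma HilbertBasis.repr_diag (b : HilbertBasis ι ℂ H) (m : ι → ℂ) (hm : ∀ i, ‖m i‖ ≤ 1) (u : H)
    (i : ι) : b.repr (b.diag m hm u) i = m i * b.repr u i := by
  simp [HilbertBasis.diag]

lemma HilbertBasis.ext_repr (b : HilbertBasis ι ℂ H) {u v : H}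
    (h : ∀ i, b.repr u i = b.repr v i) : u = v :=
  b.repr.injective (lp.ext (funext h))

lemma norm_exp_neg_mul_le_one {z : ℂ} (hz : 0 < z.re) {t s : ℝ} (ht : 0 ≤ t) (hs : 0 ≤ s) :
    ‖Complex.exp (-(z * (t * s)))‖ ≤ 1 := by
  rw [Complex.norm_exp, Real.exp_le_one_iff, ← Complex.ofReal_mul, Complex.neg_re,
    Complex.re_mul_ofReal]
  have : 0 ≤ z.re * (t * s) := by positivity
  linarith

/-- Mean value inequality on the convex left half-plane, where the derivative of `exp` has modulus
at most `1`. It dominates the difference quotients of the semigroup. -/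
lemma norm_exp_sub_one_le {ζ : ℂ} (hζ : ζ.re ≤ 0) : ‖Complex.exp ζ - 1‖ ≤ ‖ζ‖ := by
  have h := (convex_halfSpace_re_le 0).norm_image_sub_le_of_norm_deriv_le (𝕜 := ℂ)
    (f := Complex.exp) (x := 0) (y := ζ) (C := 1)
    (fun x _ => Complex.differentiableAt_exp)
    (fun x hx => by
      rw [Complex.deriv_exp, Complex.norm_exp, Real.exp_le_one_iff]
      exact hx) (by simp) hζ
  simpa using h

/-- The semigroup `exp(-t z L)`, where `L` is diagonal with eigenvalues `lam` in a Hilbert basis. -/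
def HilbertBasis.expSemigroup (b : HilbertBasis ι ℂ H) (lam : ι → ℝ) (hlam : ∀ i, 0 ≤ lam i)
    (z : ℂ) (hz : 0 < z.re) (t : ℝ) : H →L[ℂ] H :=
  -- The truncation `max t 0` keeps the multipliers bounded by `1` for negative times, whose values
  -- are irrelevant.
  b.diag (fun i => Complex.exp (-(z * ((max t 0 : ℝ) * lam i))))
    fun i => norm_exp_neg_mul_le_one hz (le_max_right _ _) (hlam i)

lemma HilbertBasis.repr_expSemigroup (b : HilbertBasis ι ℂ H) (lam : ι → ℝ)
    (hlam : ∀ i, 0 ≤ lam i) (z : ℂ) (hz : 0 < z.re) {t : ℝ} (ht : 0 ≤ t) (u : H) (i : ι) :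
    b.repr (b.expSemigroup lam hlam z hz t u) i =
      Complex.exp (-(z * (t * lam i))) * b.repr u i := by
  simp [HilbertBasis.expSemigroup, max_eq_left ht]

/-- The hypothesis `hA` requires the maximal diagonal operator. On its graph the coordinates of the
difference quotients are dominated by those of `w`, so coordinatewise convergence becomes norm
convergence; conversely, norm convergence determines every coordinate of the limit. -/
lemma HilbertBasis.isSemigroupGeneratedBy_expSemigroup (b : HilbertBasis ι ℂ H) (lam : ι → ℝ)
    (hlam : ∀ i, 0 ≤ lam i) (z : ℂ) (hz : 0 < z.re) {A : H →ₗ.[ℂ] H}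
    (hA : ∀ u w, (u, w) ∈ A.graph ↔ ∀ i, b.repr w i = -z * (lam i * b.repr u i)) :
    IsSemigroupGeneratedBy (b.expSemigroup lam hlam z hz) A := by
  have hmem : ∀ᶠ t : ℝ in 𝓝[>] 0, 0 < t := self_mem_nhdsWithin
  have hderiv : ∀ i, Tendsto (fun t : ℝ => (t : ℂ)⁻¹ * (Complex.exp (-(z * (t * lam i))) - 1))
      (𝓝[>] 0) (𝓝 (-z * lam i)) := by
    intro i
    have h : HasDerivAt (fun t : ℝ => Complex.exp (-(z * (t * lam i)))) (-z * lam i) 0 := by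
      have := ((((hasDerivAt_id (0 : ℂ)).mul_const (lam i : ℂ)).const_mul z).neg.cexp).comp_ofReal
        (z := (0 : ℝ))
      simpa using this
    have h2 := (hasDerivAt_iff_tendsto_slope.1 h).mono_left
      (nhdsWithin_mono (0 : ℝ) fun t (ht : 0 < t) => ht.ne')
    refine h2.congr fun t => ?_
    simp [slope_def_module]
  have hcoord : ∀ (u : H) (i : ι) (t : ℝ), 0 < t →
      b.repr (t⁻¹ • (b.expSemigroup lam hlam z hz t u - u)) i =
        (t : ℂ)⁻¹ * (Complex.exp (-(z * (t * lam i))) - 1) * b.repr u i := by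
    intro u i t ht
    have h1 : t⁻¹ • (b.expSemigroup lam hlam z hz t u - u) =
        ((t : ℂ)⁻¹) • (b.expSemigroup lam hlam z hz t u - u) := by
      rw [← Complex.ofReal_inv, Complex.coe_smul]
    rw [h1, map_smul, map_sub]
    simp only [lp.coeFn_smul, lp.coeFn_sub, Pi.smul_apply, Pi.sub_apply, smul_eq_mul,
      b.repr_expSemigroup lam hlam z hz ht.le]
    ring
  have hre : ∀ i (t : ℝ), 0 < t → (-(z * (t * lam i)) : ℂ).re ≤ 0 := by
    intro i t ht
    rw [← Complex.ofReal_mul, Complex.neg_re, Complex.re_mul_ofReal]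
    have : 0 ≤ z.re * (t * lam i) := mul_nonneg hz.le (mul_nonneg ht.le (hlam i))
    linarith
  constructor
  · ext u
    refine b.ext_repr fun i => ?_
    simp [b.repr_expSemigroup lam hlam z hz le_rfl]
  · intro s t hs ht
    ext u
    refine b.ext_repr fun i => ?_
    rw [ContinuousLinearMap.comp_apply, b.repr_expSemigroup lam hlam z hz (add_nonneg hs ht),
      b.repr_expSemigroup lam hlam z hz hs, b.repr_expSemigroup lam hlam z hz ht]
    have h : Complex.exp (-(z * ((s + t : ℝ) * lam i))) =
        Complex.exp (-(z * (s * lam i))) * Complex.exp (-(z * (t * lam i))) := by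
      rw [← Complex.exp_add]
      push_cast
      ring_nf
    rw [h]
    exact mul_assoc _ _ _
  · intro u
    refine b.tendsto_of_dominated (g := fun i => 2 * ‖b.repr u i‖) ?_ (fun i => ?_) ?_
    · simp only [mul_pow]
      exact (b.hasSum_norm_sq u).summable.mul_left _
    · have h1 : Tendsto (fun t : ℝ => Complex.exp (-(z * (t * lam i))) * b.repr u i) (𝓝[>] 0)
          (𝓝 (Complex.exp (-(z * ((0 : ℝ) * lam i))) * b.repr u i)) := by
        refine (Continuous.tendsto ?_ 0).mono_left nhdsWithin_le_nhds
        fun_prop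
      simp only [Complex.ofReal_zero, zero_mul, mul_zero, neg_zero, Complex.exp_zero,
        one_mul] at h1
      refine h1.congr' ?_
      filter_upwards [hmem] with t ht
      rw [b.repr_expSemigroup lam hlam z hz ht.le]
    · filter_upwards [hmem] with t ht i
      rw [b.repr_expSemigroup lam hlam z hz ht.le]
      refine (norm_sub_le _ _).trans ?_
      rw [norm_mul, two_mul]
      gcongr
      exact mul_le_of_le_one_left (norm_nonneg _) (norm_exp_neg_mul_le_one hz ht.le (hlam i))
  · intro u w
    rw [hA]
    constructor
    · intro h
      refine b.tendsto_of_dominated (g := fun i => 2 * ‖b.repr w i‖) ?_ (fun i => ?_) ?_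
      · simp only [mul_pow]
        exact (b.hasSum_norm_sq w).summable.mul_left _
      · rw [h i, ← mul_assoc]
        refine ((hderiv i).mul_const _).congr' ?_
        filter_upwards [hmem] with t ht
        rw [hcoord u i t ht]
      · filter_upwards [hmem] with t ht i
        refine (norm_sub_le _ _).trans ?_
        rw [two_mul]
        gcongr
        rw [hcoord u i t ht, h i, norm_mul, norm_mul, norm_inv]
        have h1 := norm_exp_sub_one_le (hre i t ht)
        have h2 : ‖(t : ℂ)‖ = t := by simp [abs_of_pos ht]
        calc ‖(t : ℂ)‖⁻¹ * ‖Complex.exp (-(z * (t * lam i))) - 1‖ * ‖b.repr u i‖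
            ≤ ‖(t : ℂ)‖⁻¹ * ‖-(z * (t * lam i))‖ * ‖b.repr u i‖ := by gcongr
          _ = _ := by
            simp only [norm_neg, norm_mul, h2]
            field_simp
    · intro h i
      have h1 : Tendsto (fun t : ℝ => b.repr (t⁻¹ • (b.expSemigroup lam hlam z hz t u - u)) i)
          (𝓝[>] 0) (𝓝 (b.repr w i)) := by
        have hc : Continuous fun v : H => b.repr v i := by
          simp only [b.repr_apply_apply]
          fun_prop
        exact (hc.tendsto w).comp h
      have h2 : Tendsto (fun t : ℝ => b.repr (t⁻¹ • (b.expSemigroup lam hlam z hz t u - u)) i)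
          (𝓝[>] 0) (𝓝 (-z * (lam i * b.repr u i))) := by
        rw [← mul_assoc]
        refine ((hderiv i).mul_const _).congr' ?_
        filter_upwards [hmem] with t ht
        rw [hcoord u i t ht]
      exact tendsto_nhds_unique h1 h2

end Diagonal

/-! ### Integral operators with a product bound -/

section Kernel

variable {X : Type*} [MeasurableSpace X] {μ : Measure X} {p p' q : ℝ≥0∞}

/-- A kernel dominated by `A x * B y` with `A ∈ L^q` and `B ∈ L^{p'}` defines a bounded operator
`L^p → L^q`. -/
lemma exists_integralOperator [SFinite μ] [hpp : ENNReal.HolderConjugate p' p] {K : X → X → ℂ}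
    (hK : Measurable (Function.uncurry K)) {A B : X → ℝ} (hA : MemLp A q μ)
    (hB : MemLp B p' μ) (hKAB : ∀ x y, ‖K x y‖ ≤ A x * B y) :
    ∃ T : Lp ℂ p μ →ₗ[ℂ] Lp ℂ q μ, (∃ C : ℝ, ∀ g, ‖T g‖ ≤ C * ‖g‖) ∧
      ∀ g, T g =ᵐ[μ] fun x => ∫ y, K x y * g y ∂μ := by
  have hKx : ∀ x, Measurable (K x) := fun x => hK.comp measurable_prodMk_left
  have hBg : ∀ g : Lp ℂ p μ, Integrable (fun y => B y * ‖g y‖) μ := fun g =>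
    hB.integrable_mul (Lp.memLp g).norm
  have hint : ∀ (g : Lp ℂ p μ) x, Integrable (fun y => K x y * g y) μ := fun g x => by
    refine ((hBg g).const_mul (A x)).mono
      ((hKx x).aestronglyMeasurable.mul (Lp.aestronglyMeasurable g)) (ae_of_all _ fun y => ?_)
    rw [norm_mul, Real.norm_eq_abs]
    refine le_trans ?_ (le_abs_self _)
    rw [← mul_assoc]
    gcongr
    exact hKAB x y
  have hmeas : ∀ g : Lp ℂ p μ, StronglyMeasurable fun x => ∫ y, K x y * g y ∂μ := fun g => by
    have h : StronglyMeasurable (Function.uncurry fun x y => K x y * g y) :=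
      hK.stronglyMeasurable.mul ((Lp.stronglyMeasurable g).comp_measurable measurable_snd)
    exact h.integral_prod_right
  have hpos : ∀ x y, 0 ≤ A x * B y := fun x y => (norm_nonneg _).trans (hKAB x y)
  -- Hölder in `y` alone, with `A x` pulled out; taking the `L^q` norm in `x` afterwards costs only
  -- the norm of `A`.
  have hbound : ∀ (g : Lp ℂ p μ) x,
      ‖∫ y, K x y * g y ∂μ‖ ≤ ((eLpNorm B p' μ).toReal * ‖g‖) * ‖A x‖ := fun g x => by
    have h1 : ∫ y, ‖B y‖ * ‖g y‖ ∂μ ≤ (eLpNorm B p' μ).toReal * ‖g‖ := by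
      have h2 : eLpNorm (B • fun y => ‖g y‖) 1 μ ≤ eLpNorm B p' μ * eLpNorm (fun y => ‖g y‖) p μ :=
        eLpNorm_smul_le_mul_eLpNorm (Lp.memLp g).norm.1 hB.1
      rw [eLpNorm_norm] at h2
      have h3 := ENNReal.toReal_mono (ENNReal.mul_ne_top hB.2.ne (Lp.memLp g).2.ne) h2
      rw [ENNReal.toReal_mul, ← Lp.norm_def] at h3
      refine le_trans (le_of_eq ?_) h3
      rw [eLpNorm_one_eq_lintegral_enorm, ← integral_norm_eq_lintegral_enorm
        (hB.1.smul (Lp.memLp g).norm.1)]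
      simp
    calc ‖∫ y, K x y * g y ∂μ‖ ≤ ∫ y, ‖A x‖ * (‖B y‖ * ‖g y‖) ∂μ := by
          refine norm_integral_le_of_norm_le ?_ (ae_of_all _ fun y => ?_)
          · refine ((hBg g).norm.congr (ae_of_all _ fun y => ?_)).const_mul _
            simp
          · rw [norm_mul, ← mul_assoc, ← norm_mul (A x)]
            exact mul_le_mul_of_nonneg_right ((hKAB x y).trans (le_abs_self _)) (norm_nonneg _)
      _ = ‖A x‖ * ∫ y, ‖B y‖ * ‖g y‖ ∂μ := integral_const_mul _ _
      _ ≤ _ := by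
        exact (mul_le_mul_of_nonneg_left h1 (norm_nonneg _)).trans (mul_comm _ _).le
  have hnonneg : ∀ g : Lp ℂ p μ, 0 ≤ (eLpNorm B p' μ).toReal * ‖g‖ := fun g => by
    rw [Lp.norm_def]
    positivity
  have hmem : ∀ g : Lp ℂ p μ, MemLp (fun x => ∫ y, K x y * g y ∂μ) q μ := fun g =>
    hA.of_le_mul (hmeas g).aestronglyMeasurable (ae_of_all _ (hbound g))
  refine ⟨{ toFun := fun g => (hmem g).toLp _
            map_add' := fun f g => ?_
            map_smul' := fun c g => ?_ },
    ⟨(eLpNorm B p' μ).toReal * (eLpNorm A q μ).toReal, fun g => ?_⟩, fun g => (hmem g).coeFn_toLp⟩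
  · rw [← MemLp.toLp_add]
    refine MemLp.toLp_congr _ _ (ae_of_all _ fun x => ?_)
    simp only [Pi.add_apply]
    rw [← integral_add (hint f x) (hint g x)]
    refine integral_congr_ae ?_
    filter_upwards [Lp.coeFn_add f g] with y hy
    rw [hy, Pi.add_apply, mul_add]
  · rw [RingHom.id_apply, ← MemLp.toLp_const_smul]
    refine MemLp.toLp_congr _ _ (ae_of_all _ fun x => ?_)
    simp only [Pi.smul_apply, smul_eq_mul]
    rw [← integral_const_mul]
    refine integral_congr_ae ?_
    filter_upwards [Lp.coeFn_smul c g] with y hy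
    rw [hy, Pi.smul_apply, smul_eq_mul, mul_left_comm]
  · simp only [LinearMap.coe_mk, AddHom.coe_mk, Lp.norm_toLp]
    have h1 : eLpNorm (fun x => ∫ y, K x y * g y ∂μ) q μ ≤
        eLpNorm (((eLpNorm B p' μ).toReal * ‖g‖) • A) q μ := by
      refine eLpNorm_mono_ae (ae_of_all _ fun x => ?_)
      rw [Pi.smul_apply, norm_smul, Real.norm_of_nonneg (hnonneg g)]
      exact hbound g x
    have h2 := ENNReal.toReal_mono (hA.const_smul _).2.ne h1
    refine h2.trans (le_of_eq ?_)
    rw [eLpNorm_const_smul, ENNReal.toReal_mul, toReal_enorm, Real.norm_of_nonneg (hnonneg g)]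
    ring

end Kernel

/-! ### The Gaussian measure -/

section Gaussian

variable {d : ℕ}

local notation "𝔼" => EuclideanSpace ℝ (Fin d)

/-- The Gaussian density. -/
def gaussDensity (d : ℕ) (x : EuclideanSpace ℝ (Fin d)) : ℝ :=
  (2 * Real.pi) ^ (-(d : ℝ) / 2) * Real.exp (-‖x‖ ^ 2 / 2)

lemma gaussDensity_pos (x : 𝔼) : 0 < gaussDensity d x := by
  unfold gaussDensity
  positivity

lemma continuous_gaussDensity : Continuous (gaussDensity d) := by
  unfold gaussDensity
  fun_prop

lemma integral_gaussianRd (f : 𝔼 → ℂ) :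
    ∫ x, f x ∂(gaussianRd d) = ∫ x, gaussDensity d x * f x := by
  have h := integral_withDensity_eq_integral_toReal_smul (μ := volume)
    (f := fun x => ENNReal.ofReal (gaussDensity d x))
    continuous_gaussDensity.measurable.ennreal_ofReal (ae_of_all _ fun _ => ENNReal.ofReal_lt_top) f
  refine h.trans (integral_congr_ae (ae_of_all _ fun x => ?_))
  simp [ENNReal.toReal_ofReal (gaussDensity_pos x).le]

lemma integrable_gaussianRd_iff {F : Type*} [NormedAddCommGroup F] [NormedSpace ℝ F] {f : 𝔼 → F} :
    Integrable f (gaussianRd d) ↔ Integrable fun x => gaussDensity d x • f x := by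
  have h := integrable_withDensity_iff_integrable_smul' (μ := volume)
    (f := fun x => ENNReal.ofReal (gaussDensity d x))
    continuous_gaussDensity.measurable.ennreal_ofReal (ae_of_all _ fun _ => ENNReal.ofReal_lt_top)
    (g := f)
  refine h.trans ?_
  simp [ENNReal.toReal_ofReal (gaussDensity_pos _).le]

lemma integrable_exp_neg_mul_norm_sq {b : ℝ} (hb : 0 < b) :
    Integrable fun x : 𝔼 => Real.exp (-b * ‖x‖ ^ 2) := by
  have h := (GaussianFourier.integrable_cexp_neg_mul_sq_norm_add (V := 𝔼) (b := b)
    (by simpa using hb) 0 0).norm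
  refine h.congr (ae_of_all _ fun x => ?_)
  simp only [zero_mul, add_zero, Complex.norm_exp]
  norm_cast

lemma integrable_exp_norm_sq {b : ℝ} (hb : b < 1 / 2) :
    Integrable (fun x : 𝔼 => Real.exp (b * ‖x‖ ^ 2)) (gaussianRd d) := by
  rw [integrable_gaussianRd_iff]
  refine ((integrable_exp_neg_mul_norm_sq (d := d) (show 0 < 1 / 2 - b by linarith)).const_mul
    ((2 * Real.pi) ^ (-(d : ℝ) / 2))).congr (ae_of_all _ fun x => ?_)
  simp only [gaussDensity, smul_eq_mul]
  rw [mul_assoc, ← Real.exp_add]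
  ring_nf

instance : IsFiniteMeasure (gaussianRd d) := by
  have h := integrable_exp_norm_sq (d := d) (show (0 : ℝ) < 1 / 2 by norm_num)
  simp only [zero_mul, Real.exp_zero] at h
  exact (integrable_const_iff_isFiniteMeasure one_ne_zero).1 h

lemma integrable_exp_norm (k : ℝ) :
    Integrable (fun x : 𝔼 => Real.exp (k * ‖x‖)) (gaussianRd d) := by
  refine ((integrable_exp_norm_sq (d := d) (show (1 / 4 : ℝ) < 1 / 2 by norm_num)).const_mul
    (Real.exp (k ^ 2))).mono (by fun_prop) (ae_of_all _ fun x => ?_)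
  rw [Real.norm_of_nonneg (by positivity), Real.norm_of_nonneg (by positivity), ← Real.exp_add,
    Real.exp_le_exp]
  nlinarith [sq_nonneg (k - ‖x‖ / 2)]

/-- The `q`-th power has exponent `bq|x|²`, to be beaten by `|x|²/2` from the Gaussian density. The
strict threshold is the reason for the loss `ε` in the kernel bound. -/
lemma memLp_exp_norm_sq {b q : ℝ} (hq : 0 < q) (hb : b * q < 1 / 2) :
    MemLp (fun x : 𝔼 => Real.exp (b * ‖x‖ ^ 2)) (ENNReal.ofReal q) (gaussianRd d) := by
  rw [← integrable_norm_rpow_iff (by fun_prop) (by simpa using hq) (by simp),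
    ENNReal.toReal_ofReal hq.le]
  refine (integrable_exp_norm_sq (d := d) hb).congr (ae_of_all _ fun x => ?_)
  simp only [Real.norm_eq_abs, Real.abs_exp]
  rw [← Real.exp_mul]
  ring_nf

/-- Functions of at most exponential growth. -/
def ExpBounded {F : Type*} [Norm F] (f : 𝔼 → F) : Prop :=
  ∃ C k : ℝ, ∀ x, ‖f x‖ ≤ C * Real.exp (k * ‖x‖)

lemma ExpBounded.mul {f g : 𝔼 → ℂ} (hf : ExpBounded f) (hg : ExpBounded g) :
    ExpBounded fun x => f x * g x := by
  obtain ⟨C, k, hf⟩ := hf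
  obtain ⟨C', k', hg⟩ := hg
  refine ⟨C * C', k + k', fun x => ?_⟩
  rw [norm_mul, add_mul, Real.exp_add]
  calc ‖f x‖ * ‖g x‖ ≤ (C * Real.exp (k * ‖x‖)) * (C' * Real.exp (k' * ‖x‖)) :=
        mul_le_mul (hf x) (hg x) (norm_nonneg _) ((norm_nonneg _).trans (hf x))
    _ = _ := by ring

lemma ExpBounded.add {F : Type*} [SeminormedAddCommGroup F] {f g : 𝔼 → F} (hf : ExpBounded f)
    (hg : ExpBounded g) : ExpBounded fun x => f x + g x := by
  obtain ⟨C, k, hf⟩ := hf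
  obtain ⟨C', k', hg⟩ := hg
  -- The constants carry no sign condition; absolute values allow both bounds to be enlarged to a
  -- common one.
  refine ⟨|C| + |C'|, |k| + |k'|, fun x => ?_⟩
  have h1 : C * Real.exp (k * ‖x‖) ≤ |C| * Real.exp ((|k| + |k'|) * ‖x‖) := by
    gcongr
    · exact le_abs_self C
    · linarith [le_abs_self k, abs_nonneg k']
  have h2 : C' * Real.exp (k' * ‖x‖) ≤ |C'| * Real.exp ((|k| + |k'|) * ‖x‖) := by
    gcongr
    · exact le_abs_self C'
    · linarith [le_abs_self k', abs_nonneg k]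
  rw [add_mul]
  exact (norm_add_le _ _).trans (add_le_add ((hf x).trans h1) ((hg x).trans h2))

lemma ExpBounded.mono {F G : Type*} [Norm F] [Norm G] {f : 𝔼 → F} {g : 𝔼 → G}
    (hg : ExpBounded g) (h : ∀ x, ‖f x‖ ≤ ‖g x‖) : ExpBounded f := by
  obtain ⟨C, k, hg⟩ := hg
  exact ⟨C, k, fun x => (h x).trans (hg x)⟩

lemma ExpBounded.of_bound {F : Type*} [Norm F] {f : 𝔼 → F} (C : ℝ) (h : ∀ x, ‖f x‖ ≤ C) :
    ExpBounded f := ⟨C, 0, fun x => by simpa using h x⟩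

lemma ExpBounded.const_mul {f : 𝔼 → ℂ} (hf : ExpBounded f) (c : ℂ) :
    ExpBounded fun x => c * f x :=
  (ExpBounded.of_bound ‖c‖ fun _ => le_rfl).mul hf

lemma ExpBounded.sum {κ : Type*} (s : Finset κ) {f : κ → 𝔼 → ℂ} (hf : ∀ i ∈ s, ExpBounded (f i)) :
    ExpBounded fun x => ∑ i ∈ s, f i x := by
  classical
  induction s using Finset.induction_on with
  | empty => exact ExpBounded.of_bound 0 (by simp)
  | insert a s ha ih =>
    simp only [Finset.sum_insert ha]
    exact (hf a (Finset.mem_insert_self a s)).add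
      (ih fun i hi => hf i (Finset.mem_insert_of_mem hi))

lemma norm_le_exp_norm (x : 𝔼) : ‖x‖ ≤ 1 * Real.exp (1 * ‖x‖) := by
  have := Real.add_one_le_exp ‖x‖
  simp only [one_mul]
  linarith

lemma expBounded_id : ExpBounded fun x : 𝔼 => x := ⟨1, 1, norm_le_exp_norm⟩

lemma expBounded_inner (v : 𝔼) : ExpBounded fun x : 𝔼 => ((inner ℝ v x : ℝ) : ℂ) := by
  refine ⟨‖v‖, 1, fun x => ?_⟩
  rw [Complex.norm_real]
  refine (norm_inner_le_norm v x).trans ?_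
  have := norm_le_exp_norm x
  rw [one_mul] at this
  gcongr

lemma expBounded_pow {f : 𝔼 → ℂ} (hf : ExpBounded f) (n : ℕ) : ExpBounded fun x => f x ^ n := by
  induction n with
  | zero => exact ExpBounded.of_bound 1 (by simp)
  | succ n ih =>
    simp only [pow_succ]
    exact ih.mul hf

lemma ExpBounded.integrable {F : Type*} [NormedAddCommGroup F] {f : 𝔼 → F}
    (hf : ExpBounded f) (hm : AEStronglyMeasurable f (gaussianRd d)) :
    Integrable f (gaussianRd d) := by
  obtain ⟨C, k, hf⟩ := hf
  exact ((integrable_exp_norm k).const_mul C).mono' hm (ae_of_all _ hf)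

lemma ExpBounded.memLp_two {F : Type*} [NormedAddCommGroup F] {f : 𝔼 → F}
    (hf : ExpBounded f) (hm : AEStronglyMeasurable f (gaussianRd d)) :
    MemLp f 2 (gaussianRd d) := by
  rw [← integrable_norm_rpow_iff hm (by simp) (by simp)]
  obtain ⟨C, k, hf⟩ := hf
  refine ((integrable_exp_norm (2 * k)).const_mul (C ^ 2)).mono'
    (by simp only [ENNReal.toReal_ofNat, Real.rpow_ofNat]; exact hm.norm.pow 2)
    (ae_of_all _ fun x => ?_)
  have h1 : Real.exp (2 * k * ‖x‖) = Real.exp (k * ‖x‖) ^ 2 := by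
    rw [← Real.exp_nat_mul]
    push_cast
    ring_nf
  rw [h1, ← mul_pow]
  simp only [ENNReal.toReal_ofNat, Real.rpow_ofNat, norm_pow, norm_norm]
  have := hf x
  gcongr

end Gaussian

section OrnsteinUhlenbeck

variable {d : ℕ}

local notation "𝔼" => EuclideanSpace ℝ (Fin d)

/-! ### Integration by parts -/

lemma hasFDerivAt_gaussDensity (x : 𝔼) :
    HasFDerivAt (fun y : 𝔼 => (gaussDensity d y : ℂ))
      (-(gaussDensity d x) • (Complex.ofRealCLM.comp (innerSL ℝ x))) x := by
  have h1 : HasFDerivAt (fun y : 𝔼 => -‖y‖ ^ 2 / 2) (-(innerSL ℝ x)) x := by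
    have := ((hasStrictFDerivAt_norm_sq x).hasFDerivAt.neg).mul_const (1 / 2 : ℝ)
    refine (this.congr_fderiv ?_).congr_of_eventuallyEq (Eventually.of_forall fun y => ?_)
    · ext v; simp
    · simp; ring
  have h2 := (h1.exp.const_mul ((2 * Real.pi) ^ (-(d : ℝ) / 2)))
  refine (Complex.ofRealCLM.hasFDerivAt.comp x h2).congr_fderiv ?_
  ext v
  simp [gaussDensity]
  ring

/-- Gaussian integration by parts. -/
lemma integral_fderiv_gaussianRd {f : 𝔼 → ℂ} (v : 𝔼) (hf : ContDiff ℝ 1 f) (hb : ExpBounded f)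
    (hb' : ExpBounded fun x => fderiv ℝ f x v) :
    ∫ x, fderiv ℝ f x v ∂(gaussianRd d) = ∫ x, f x * (inner ℝ v x : ℝ) ∂(gaussianRd d) := by
  have hcf : Continuous fun x => fderiv ℝ f x v :=
    (hf.continuous_fderiv one_ne_zero).clm_apply continuous_const
  have hg : ∀ x : 𝔼, fderiv ℝ (fun y : 𝔼 => (gaussDensity d y : ℂ)) x v =
      -(gaussDensity d x) * (inner ℝ v x : ℝ) := fun x => by
    rw [(hasFDerivAt_gaussDensity x).fderiv]
    simp [real_inner_comm]
  have hi1 := integrable_gaussianRd_iff.1 (hb.integrable hf.continuous.aestronglyMeasurable)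
  have hi2 := integrable_gaussianRd_iff.1 (hb'.integrable hcf.aestronglyMeasurable)
  have hi3 := integrable_gaussianRd_iff.1 ((hb.mul (expBounded_inner v)).integrable
    (hf.continuous.mul (by fun_prop)).aestronglyMeasurable)
  -- Lebesgue integration by parts against the density, whose derivative along `v` is `-⟨v, x⟩`
  -- times itself.
  have h := integral_mul_fderiv_eq_neg_fderiv_mul_of_integrable (μ := (volume : Measure 𝔼))
    (f := f) (g := fun y => (gaussDensity d y : ℂ)) (v := v)
    (hi2.congr (ae_of_all _ fun x => by simp [mul_comm]))
    (hi3.neg.congr (ae_of_all _ fun x => by simp only [hg]; simp; ring))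
    (hi1.congr (ae_of_all _ fun x => by simp [mul_comm]))
    (fun x _ => hf.differentiable one_ne_zero x)
    (fun x _ => (hasFDerivAt_gaussDensity x).differentiableAt)
  rw [integral_gaussianRd, integral_gaussianRd]
  simp only [hg] at h
  rw [← neg_eq_iff_eq_neg, ← integral_neg] at h
  calc _ = ∫ x, fderiv ℝ f x v * gaussDensity d x := by simp only [mul_comm]
    _ = _ := by
      rw [← h]
      refine integral_congr_ae (ae_of_all _ fun x => ?_)
      simp only
      ring

/-- Twice continuously differentiable functions which have, together with their derivatives, at most
exponential growth. -/
structure Tame (f : 𝔼 → ℂ) : Prop where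
  contDiff : ContDiff ℝ 2 f
  growth : ∀ i ≤ 2, ExpBounded fun x => iteratedFDeriv ℝ i f x

lemma Tame.expBounded {f : 𝔼 → ℂ} (hf : Tame f) : ExpBounded f :=
  (hf.growth 0 (by norm_num)).mono fun x => by simp

lemma Tame.expBounded_fderiv {f : 𝔼 → ℂ} (hf : Tame f) : ExpBounded fun x => fderiv ℝ f x :=
  (hf.growth 1 (by norm_num)).mono fun x => by simp

lemma ExpBounded.clm_apply {f : 𝔼 → 𝔼 →L[ℝ] ℂ} {g : 𝔼 → 𝔼} (hf : ExpBounded f)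
    (hg : ExpBounded g) : ExpBounded fun x => f x (g x) := by
  obtain ⟨C, k, hf⟩ := hf
  obtain ⟨C', k', hg⟩ := hg
  refine ⟨C * C', k + k', fun x => ?_⟩
  rw [add_mul, Real.exp_add]
  calc ‖f x (g x)‖ ≤ ‖f x‖ * ‖g x‖ := (f x).le_opNorm _
    _ ≤ (C * Real.exp (k * ‖x‖)) * (C' * Real.exp (k' * ‖x‖)) :=
        mul_le_mul (hf x) (hg x) (norm_nonneg _) ((norm_nonneg _).trans (hf x))
    _ = _ := by ring

lemma Tame.expBounded_fderiv_apply {f : 𝔼 → ℂ} (hf : Tame f) (v : 𝔼) :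
    ExpBounded fun x => fderiv ℝ f x v :=
  hf.expBounded_fderiv.clm_apply (.of_bound ‖v‖ fun _ => le_rfl)

lemma Tame.expBounded_iteratedFDeriv_apply {f : 𝔼 → ℂ} (hf : Tame f) (v : 𝔼) :
    ExpBounded fun x => iteratedFDeriv ℝ 2 f x ![v, v] := by
  obtain ⟨C, k, h⟩ := hf.growth 2 le_rfl
  refine ⟨C * ‖v‖ ^ 2, k, fun x => ?_⟩
  refine (ContinuousMultilinearMap.le_opNorm _ _).trans ?_
  simp only [Fin.prod_univ_two, Matrix.cons_val_zero, Matrix.cons_val_one]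
  nlinarith [mul_le_mul_of_nonneg_right (h x) (sq_nonneg ‖v‖)]

lemma ouExpr_eq_sum (f : 𝔼 → ℂ) (x : 𝔼) :
    ouExpr f x = ∑ i, ((inner ℝ (EuclideanSpace.basisFun (Fin d) ℝ i) x : ℝ) *
        fderiv ℝ f x (EuclideanSpace.basisFun (Fin d) ℝ i)
      - iteratedFDeriv ℝ 2 f x ![EuclideanSpace.basisFun (Fin d) ℝ i,
          EuclideanSpace.basisFun (Fin d) ℝ i]) := by
  rw [ouExpr, InnerProductSpace.laplacian_eq_iteratedFDeriv_orthonormalBasis f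
    (EuclideanSpace.basisFun (Fin d) ℝ), Finset.sum_sub_distrib, neg_add_eq_sub]
  congr 1
  have h := congrArg (fderiv ℝ f x) ((EuclideanSpace.basisFun (Fin d) ℝ).sum_repr' x)
  rw [← h, map_sum]
  exact Finset.sum_congr rfl fun i _ => by rw [map_smul, Complex.real_smul]

lemma continuous_ouExpr {f : 𝔼 → ℂ} (hf : ContDiff ℝ 2 f) : Continuous (ouExpr f) := by
  have h : ouExpr f = fun x => _ := funext fun x => ouExpr_eq_sum f x
  rw [h]
  refine continuous_finsetSum _ fun i _ => ?_
  refine Continuous.sub (Continuous.mul (by fun_prop) ?_) ?_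
  · exact (hf.continuous_fderiv two_ne_zero).clm_apply continuous_const
  · exact (ContinuousMultilinearMap.apply ℝ (fun _ : Fin 2 => 𝔼) ℂ _).continuous.comp
      (hf.continuous_iteratedFDeriv le_rfl)

lemma Tame.expBounded_ouExpr {f : 𝔼 → ℂ} (hf : Tame f) : ExpBounded (ouExpr f) := by
  have h : ouExpr f = fun x => _ := funext fun x => ouExpr_eq_sum f x
  rw [h]
  refine ExpBounded.sum _ fun i _ => ?_
  simp only [sub_eq_add_neg]
  exact ((expBounded_inner _).mul (hf.expBounded_fderiv_apply _)).add
    ((hf.expBounded_iteratedFDeriv_apply _).mono fun x => (norm_neg _).le)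

/-- The Dirichlet form of the Ornstein--Uhlenbeck operator. -/
lemma integral_mul_ouExpr {f g : 𝔼 → ℂ} (hf : Tame f) (hg : Tame g) :
    ∫ x, f x * ouExpr g x ∂(gaussianRd d) =
      ∑ i, ∫ x, fderiv ℝ f x (EuclideanSpace.basisFun (Fin d) ℝ i) *
        fderiv ℝ g x (EuclideanSpace.basisFun (Fin d) ℝ i) ∂(gaussianRd d) := by
  have hdf := hf.contDiff.differentiable two_ne_zero
  have hcf := hf.contDiff.continuous
  have hcf' : ∀ v, Continuous fun x => fderiv ℝ f x v := fun v =>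
    (hf.contDiff.continuous_fderiv two_ne_zero).clm_apply continuous_const
  have hcg' : ∀ v, Continuous fun x => fderiv ℝ g x v := fun v =>
    (hg.contDiff.continuous_fderiv two_ne_zero).clm_apply continuous_const
  have hcg'' : ∀ v, Continuous fun x => iteratedFDeriv ℝ 2 g x ![v, v] := fun v =>
    (ContinuousMultilinearMap.apply ℝ (fun _ : Fin 2 => 𝔼) ℂ _).continuous.comp
      (hg.contDiff.continuous_iteratedFDeriv le_rfl)
  have hi1 : ∀ v, Integrable (fun x => fderiv ℝ f x v * fderiv ℝ g x v) (gaussianRd d) := fun v =>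
    ((hf.expBounded_fderiv_apply v).mul (hg.expBounded_fderiv_apply v)).integrable
      ((hcf' v).mul (hcg' v)).aestronglyMeasurable
  have hi2 : ∀ v, Integrable (fun x => f x * iteratedFDeriv ℝ 2 g x ![v, v]) (gaussianRd d) :=
    fun v => (hf.expBounded.mul (hg.expBounded_iteratedFDeriv_apply v)).integrable
      (hcf.mul (hcg'' v)).aestronglyMeasurable
  have hb3 : ∀ v, ExpBounded fun x => f x * fderiv ℝ g x v := fun v =>
    hf.expBounded.mul (hg.expBounded_fderiv_apply v)
  have hi3 : ∀ v, Integrable (fun x => f x * fderiv ℝ g x v * (inner ℝ v x : ℝ)) (gaussianRd d) :=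
    fun v => ((hb3 v).mul (expBounded_inner v)).integrable
      ((hcf.mul (hcg' v)).mul (by fun_prop)).aestronglyMeasurable
  -- Gaussian integration by parts applied to the product `f · ∂ᵥg`, one direction at a time.
  have key : ∀ v : 𝔼, ∫ x, f x * ((inner ℝ v x : ℝ) * fderiv ℝ g x v
      - iteratedFDeriv ℝ 2 g x ![v, v]) ∂(gaussianRd d) =
      ∫ x, fderiv ℝ f x v * fderiv ℝ g x v ∂(gaussianRd d) := by
    intro v
    have hC1 : ContDiff ℝ 1 fun x => fderiv ℝ g x v :=
      (hg.contDiff.fderiv_right (m := 1) (by norm_num)).clm_apply contDiff_const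
    have hD : ∀ x, fderiv ℝ (fun x => f x * fderiv ℝ g x v) x v =
        fderiv ℝ f x v * fderiv ℝ g x v + f x * iteratedFDeriv ℝ 2 g x ![v, v] := by
      intro x
      have hdd : DifferentiableAt ℝ (fderiv ℝ g) x :=
        (hg.contDiff.fderiv_right (m := 1) (by norm_num)).differentiable one_ne_zero x
      have h2 : fderiv ℝ (fun y => fderiv ℝ g y v) x v = iteratedFDeriv ℝ 2 g x ![v, v] := by
        rw [iteratedFDeriv_two_apply, fderiv_clm_apply hdd (differentiableAt_const v)]
        simp
      rw [fderiv_fun_mul (hdf x) (hC1.differentiable one_ne_zero x)]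
      simp [h2]
      ring
    have h := integral_fderiv_gaussianRd v ((hf.contDiff.of_le (by norm_num)).mul hC1) (hb3 v) (by
      simp only [hD]
      exact ((hf.expBounded_fderiv_apply v).mul (hg.expBounded_fderiv_apply v)).add
        (hf.expBounded.mul (hg.expBounded_iteratedFDeriv_apply v)))
    simp only [hD] at h
    rw [integral_add (hi1 v) (hi2 v)] at h
    rw [← add_sub_cancel_right (∫ x, fderiv ℝ f x v * fderiv ℝ g x v ∂(gaussianRd d)), h,
      ← integral_sub (hi3 v) (hi2 v)]
    refine integral_congr_ae (ae_of_all _ fun x => ?_)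
    simp only
    ring
  simp only [ouExpr_eq_sum, Finset.mul_sum]
  rw [integral_finsetSum]
  · exact Finset.sum_congr rfl fun i _ => key _
  · intro i _
    refine ((hi3 (EuclideanSpace.basisFun (Fin d) ℝ i)).sub
      (hi2 (EuclideanSpace.basisFun (Fin d) ℝ i))).congr (ae_of_all _ fun x => ?_)
    simp only [Pi.sub_apply]
    ring

/-- The Ornstein--Uhlenbeck operator is symmetric. -/
lemma integral_mul_ouExpr_comm {f g : 𝔼 → ℂ} (hf : Tame f) (hg : Tame g) :
    ∫ x, f x * ouExpr g x ∂(gaussianRd d) = ∫ x, ouExpr f x * g x ∂(gaussianRd d) := by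
  simp only [mul_comm (ouExpr f _)]
  rw [integral_mul_ouExpr hf hg, integral_mul_ouExpr hg hf]
  simp only [mul_comm]

lemma tame_of_hasCompactSupport {f : 𝔼 → ℂ} (hf : ContDiff ℝ 2 f) (hc : HasCompactSupport f) :
    Tame f := by
  refine ⟨hf, fun i hi => ?_⟩
  obtain ⟨C, hC⟩ := (hc.iteratedFDeriv (𝕜 := ℝ) i).exists_bound_of_continuous
    (hf.continuous_iteratedFDeriv (by exact_mod_cast hi))
  exact .of_bound C hC

/-! ### Cut-off -/

/-- Dominated convergence in `L²(γ)`. -/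
lemma tendsto_toLp_two {F : ℕ → 𝔼 → ℂ} {f : 𝔼 → ℂ} {B : 𝔼 → ℝ}
    (hF : ∀ n, MemLp (F n) 2 (gaussianRd d))
    (hf : MemLp f 2 (gaussianRd d)) (hB : MemLp B 2 (gaussianRd d))
    (hFB : ∀ n x, ‖F n x‖ ≤ B x) (hlim : ∀ x, Tendsto (fun n => F n x) atTop (𝓝 (f x))) :
    Tendsto (fun n => (hF n).toLp (F n)) atTop (𝓝 (hf.toLp f)) := by
  rw [Lp.tendsto_Lp_iff_tendsto_eLpNorm'']
  have hfB : ∀ x, ‖f x‖ ≤ B x := fun x => le_of_tendsto (hlim x).norm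
    (Eventually.of_forall fun n => hFB n x)
  have h : Tendsto (fun n => ∫⁻ x, ‖(F n - f) x‖ₑ ^ (2 : ℝ) ∂(gaussianRd d)) atTop
      (𝓝 (∫⁻ _, 0 ∂(gaussianRd d))) := by
    refine tendsto_lintegral_of_dominated_convergence' (bound := fun x => ‖2 * B x‖ₑ ^ (2 : ℝ))
      (fun n => ((hF n).1.sub hf.1).enorm.pow_const _) (fun n => ae_of_all _ fun x => ?_) ?_
      (ae_of_all _ fun x => ?_)
    · refine ENNReal.rpow_le_rpow ?_ (by norm_num)
      refine enorm_le_iff_norm_le.2 ?_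
      refine (norm_sub_le _ _).trans ?_
      rw [Real.norm_eq_abs]
      exact (add_le_add (hFB n x) (hfB x)).trans (by rw [← two_mul]; exact le_abs_self _)
    · have h2 := (hB.const_mul 2).eLpNorm_lt_top
      have := lintegral_rpow_enorm_lt_top_of_eLpNorm_lt_top (by simp) (by simp) h2
      simpa using this.ne
    · have h1 : Tendsto (fun n => ‖(F n - f) x‖ₑ) atTop (𝓝 0) := by
        have h2 : Tendsto (fun n => F n x - f x) atTop (𝓝 0) := by
          simpa using (hlim x).sub_const (f x)
        simpa using h2.enorm
      have := (ENNReal.continuous_rpow_const (y := 2)).tendsto 0 |>.comp h1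
      simpa [Function.comp_def] using this
  have h2 := (ENNReal.continuous_rpow_const (y := 1 / 2)).tendsto _ |>.comp h
  simp only [lintegral_zero] at h2
  simp only [eLpNorm_eq_lintegral_rpow_enorm_toReal (p := 2) (by simp) (by simp),
    ENNReal.toReal_ofNat]
  simpa [Function.comp_def] using h2

lemma norm_ouExpr_le (f : 𝔼 → ℂ) (x : 𝔼) :
    ‖ouExpr f x‖ ≤ d * ‖iteratedFDeriv ℝ 2 f x‖ + ‖iteratedFDeriv ℝ 1 f x‖ * ‖x‖ := by
  rw [ouExpr, InnerProductSpace.laplacian_eq_iteratedFDeriv_orthonormalBasis f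
    (EuclideanSpace.basisFun (Fin d) ℝ)]
  refine (norm_add_le _ _).trans (add_le_add ?_ ?_)
  · rw [norm_neg]
    refine (norm_sum_le _ _).trans ?_
    refine (Finset.sum_le_card_nsmul _ _ ‖iteratedFDeriv ℝ 2 f x‖ fun i _ => ?_).trans ?_
    · refine (ContinuousMultilinearMap.le_opNorm _ _).trans ?_
      simp
    · simp
  · rw [norm_iteratedFDeriv_one]
    exact (fderiv ℝ f x).le_opNorm x

lemma ouExpr_congr {f g : 𝔼 → ℂ} {x : 𝔼} (h : f =ᶠ[𝓝 x] g) : ouExpr f x = ouExpr g x := by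
  rw [ouExpr, ouExpr, (InnerProductSpace.laplacian_congr_nhds h).eq_of_nhds, h.fderiv_eq]

lemma Tame.memLp {f : 𝔼 → ℂ} (hf : Tame f) : MemLp f 2 (gaussianRd d) :=
  hf.expBounded.memLp_two hf.contDiff.continuous.aestronglyMeasurable

lemma Tame.memLp_ouExpr {f : 𝔼 → ℂ} (hf : Tame f) : MemLp (ouExpr f) 2 (gaussianRd d) :=
  hf.expBounded_ouExpr.memLp_two (continuous_ouExpr hf.contDiff).aestronglyMeasurable

/-- Tame functions belong to the domain of the closure of the operator on test functions. -/
lemma Tame.mem_closure_ouTestGraph {f : 𝔼 → ℂ} (hf : Tame f) :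
    (hf.memLp.toLp f, hf.memLp_ouExpr.toLp (ouExpr f)) ∈ (ouTestGraph d).topologicalClosure := by
  let χ : ContDiffBump (0 : 𝔼) := ⟨1, 2, one_pos, one_lt_two⟩
  let X : 𝔼 → ℂ := fun x => (χ x : ℝ)
  have hX : ContDiff ℝ 2 X := Complex.ofRealCLM.contDiff.comp χ.contDiff
  have hXc : HasCompactSupport X :=
    χ.hasCompactSupport.comp_left (g := fun r : ℝ => (r : ℂ)) Complex.ofReal_zero
  have hM : ∃ M : ℝ, ∀ i ≤ 2, ∀ x, ‖iteratedFDeriv ℝ i X x‖ ≤ M := by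
    have h : ∀ i, ∃ M : ℝ, i ≤ 2 → ∀ x, ‖iteratedFDeriv ℝ i X x‖ ≤ M := fun i => by
      by_cases hi : i ≤ 2
      · obtain ⟨C, hC⟩ := (hXc.iteratedFDeriv (𝕜 := ℝ) i).exists_bound_of_continuous
          (hX.continuous_iteratedFDeriv (by exact_mod_cast hi))
        exact ⟨C, fun _ => hC⟩
      · exact ⟨0, fun h => absurd h hi⟩
    choose M hM using h
    refine ⟨max (M 0) (max (M 1) (M 2)), fun i hi x => (hM i hi x).trans ?_⟩
    interval_cases i <;> simp
  obtain ⟨M, hM⟩ := hM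
  have hM0 : 0 ≤ M := (norm_nonneg _).trans (hM 0 (by norm_num) 0)
  -- Dilating the bump by `a n ≤ 1` multiplies its `i`-th derivative by `a n ^ i ≤ 1`, so the bound
  -- `M` serves all cut-offs.
  let a : ℕ → ℝ := fun n => 1 / ((n : ℝ) + 1)
  have ha0 : ∀ n, 0 < a n := fun n => Nat.one_div_pos_of_nat
  have ha1 : ∀ n, a n ≤ 1 := fun n => by
    refine (div_le_one (by positivity)).2 ?_
    linarith [(n.cast_nonneg : (0 : ℝ) ≤ n)]
  let F : ℕ → 𝔼 → ℂ := fun n x => X (a n • x) * f x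
  have hXa : ∀ n, ContDiff ℝ 2 fun x : 𝔼 => X (a n • x) := fun n => hX.comp (contDiff_const_smul _)
  have hF : ∀ n, ContDiff ℝ 2 (F n) := fun n => (hXa n).mul hf.contDiff
  have hFc : ∀ n, HasCompactSupport (F n) := fun n =>
    HasCompactSupport.mul_right (hXc.comp_smul (ha0 n).ne')
  have hXai : ∀ n, ∀ i ≤ 2, ∀ x, ‖iteratedFDeriv ℝ i (fun x : 𝔼 => X (a n • x)) x‖ ≤ M := by
    intro n i hi x
    rw [iteratedFDeriv_comp_const_smul (a n) (hX.of_le (by exact_mod_cast hi)), norm_smul,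
      norm_pow, Real.norm_of_nonneg (ha0 n).le]
    calc a n ^ i * ‖iteratedFDeriv ℝ i X (a n • x)‖ ≤ 1 * M :=
          mul_le_mul (pow_le_one₀ (ha0 n).le (ha1 n)) (hM i hi _) (norm_nonneg _) zero_le_one
      _ = M := one_mul M
  let g : 𝔼 → ℝ := fun x =>
    ‖iteratedFDeriv ℝ 0 f x‖ + ‖iteratedFDeriv ℝ 1 f x‖ + ‖iteratedFDeriv ℝ 2 f x‖
  have hgb : ExpBounded g := by
    have h : ∀ i ≤ 2, ExpBounded fun x => ‖iteratedFDeriv ℝ i f x‖ := fun i hi =>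
      (hf.growth i hi).mono fun x => (norm_norm _).le
    exact ((h 0 (by norm_num)).add (h 1 (by norm_num))).add (h 2 le_rfl)
  have hgc : Continuous g := by
    have h : ∀ i ≤ 2, Continuous fun x => ‖iteratedFDeriv ℝ i f x‖ := fun i hi =>
      (hf.contDiff.continuous_iteratedFDeriv (by exact_mod_cast hi)).norm
    exact ((h 0 (by norm_num)).add (h 1 (by norm_num))).add (h 2 le_rfl)
  have hg0 : ∀ x, 0 ≤ g x := fun x => by positivity
  have hgi : ∀ i ≤ 2, ∀ x, ‖iteratedFDeriv ℝ i f x‖ ≤ g x := fun i hi x => by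
    have h0 := norm_nonneg (iteratedFDeriv ℝ 0 f x)
    have h1 := norm_nonneg (iteratedFDeriv ℝ 1 f x)
    have h2 := norm_nonneg (iteratedFDeriv ℝ 2 f x)
    interval_cases i <;> simp only [g] <;> linarith
  -- Leibniz rule; the factor `4` bounds the sum `2 ^ i` of binomial coefficients for `i ≤ 2`.
  have hFi : ∀ n, ∀ i ≤ 2, ∀ x, ‖iteratedFDeriv ℝ i (F n) x‖ ≤ 4 * M * g x := by
    intro n i hi x
    refine (norm_iteratedFDeriv_mul_le (hXa n) hf.contDiff x (by exact_mod_cast hi)).trans ?_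
    have h1 : ∀ j ∈ Finset.range (i + 1), (i.choose j : ℝ) *
        ‖iteratedFDeriv ℝ j (fun x : 𝔼 => X (a n • x)) x‖ * ‖iteratedFDeriv ℝ (i - j) f x‖ ≤
        (i.choose j : ℝ) * (M * g x) := by
      intro j hj
      rw [mul_assoc]
      have hj : j ≤ i := Finset.mem_range_succ_iff.1 hj
      exact mul_le_mul_of_nonneg_left (mul_le_mul (hXai n j (by omega) x)
        (hgi (i - j) (by omega) x) (norm_nonneg _) hM0) (Nat.cast_nonneg _)
    refine (Finset.sum_le_sum h1).trans ?_
    rw [← Finset.sum_mul, ← Nat.cast_sum, Nat.sum_range_choose, mul_assoc]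
    refine mul_le_mul_of_nonneg_right ?_ (mul_nonneg hM0 (hg0 x))
    interval_cases i <;> norm_num
  have hFt : ∀ n, Tame (F n) := fun n => tame_of_hasCompactSupport (hF n) (hFc n)
  -- Equality on a neighbourhood, and not just at `x`, makes the derivatives agree as well.
  have hev : ∀ x, ∀ᶠ n in atTop, F n =ᶠ[𝓝 x] f := by
    intro x
    obtain ⟨N, hN⟩ := exists_nat_gt ‖x‖
    filter_upwards [eventually_ge_atTop N] with n hn
    have hx : ‖x‖ < n + 1 := by
      have : (N : ℝ) ≤ n := by exact_mod_cast hn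
      linarith
    have h1 : ∀ᶠ y : 𝔼 in 𝓝 x, ‖y‖ < n + 1 := continuous_norm.continuousAt.eventually_lt_const hx
    filter_upwards [h1] with y hy
    have h2 : χ (a n • y) = 1 := by
      refine χ.one_of_mem_closedBall ?_
      rw [mem_closedBall_zero_iff, norm_smul, Real.norm_of_nonneg (ha0 n).le]
      change 1 / ((n : ℝ) + 1) * ‖y‖ ≤ 1
      rw [one_div, inv_mul_le_iff₀ (by positivity)]
      linarith
    simp [F, X, h2]
  have hlim1 : ∀ x, Tendsto (fun n => F n x) atTop (𝓝 (f x)) := fun x =>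
    tendsto_const_nhds.congr' ((hev x).mono fun n hn => hn.eq_of_nhds.symm)
  have hlim2 : ∀ x, Tendsto (fun n => ouExpr (F n) x) atTop (𝓝 (ouExpr f x)) := fun x =>
    tendsto_const_nhds.congr' ((hev x).mono fun n hn => (ouExpr_congr hn).symm)
  have hB : MemLp (fun x => 4 * M * g x) 2 (gaussianRd d) :=
    (hgb.memLp_two hgc.aestronglyMeasurable).const_mul _
  have hB' : MemLp (fun x => 4 * M * (g x * (d + ‖x‖))) 2 (gaussianRd d) := by
    refine MemLp.const_mul (ExpBounded.memLp_two ?_ (by fun_prop)) _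
    have h1 : ExpBounded fun x : 𝔼 => (d : ℝ) + ‖x‖ :=
      (ExpBounded.of_bound (d : ℝ) fun _ => by simp).add (expBounded_id.mono fun x => by simp)
    obtain ⟨C, k, h⟩ := hgb
    obtain ⟨C', k', h'⟩ := h1
    refine ⟨C * C', k + k', fun x => ?_⟩
    rw [norm_mul, add_mul, Real.exp_add]
    calc ‖g x‖ * ‖(d : ℝ) + ‖x‖‖ ≤ (C * Real.exp (k * ‖x‖)) * (C' * Real.exp (k' * ‖x‖)) :=
          mul_le_mul (h x) (h' x) (norm_nonneg _) ((norm_nonneg _).trans (h x))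
      _ = _ := by ring
  have ht1 := tendsto_toLp_two (fun n => (hFt n).memLp) hf.memLp hB (fun n x => by
    simpa using hFi n 0 (by norm_num) x) hlim1
  have ht2 := tendsto_toLp_two (fun n => (hFt n).memLp_ouExpr) hf.memLp_ouExpr hB' (fun n x => by
    refine (norm_ouExpr_le _ x).trans ?_
    have h1 := mul_le_mul_of_nonneg_left (hFi n 2 le_rfl x) (Nat.cast_nonneg (α := ℝ) d)
    have h2 := mul_le_mul_of_nonneg_right (hFi n 1 (by norm_num) x) (norm_nonneg x)
    refine (add_le_add h1 h2).trans (le_of_eq ?_)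
    ring) hlim2
  refine mem_closure_of_tendsto (ht1.prodMk_nhds ht2) (Eventually.of_forall fun n => ?_)
  exact ⟨F n, hF n, hFc n, (hFt n).memLp.coeFn_toLp, (hFt n).memLp_ouExpr.coeFn_toLp⟩

end OrnsteinUhlenbeck

section Hermite

open Polynomial

/-! ### Hermite polynomials -/

lemma derivative_hermite_succ (n : ℕ) :
    derivative (hermite (n + 1)) = ((n : ℤ[X]) + 1) * hermite n := by
  induction n with
  | zero => simp
  | succ n ih =>
    rw [hermite_succ (n + 1), derivative_sub, derivative_mul, ih, derivative_mul, derivative_X,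
      hermite_succ n]
    have h : derivative ((n : ℤ[X]) + 1) = 0 := by simp
    rw [h]
    push_cast
    ring

/-- Differentiating `Hₙ₊₁' = (n + 1) Hₙ` again reduces the claim to the recursion `Hₙ₊₁ = X Hₙ -
Hₙ'`. This is the one-dimensional eigenvalue equation. -/
lemma hermite_ode (n : ℕ) :
    X * derivative (hermite n) - derivative (derivative (hermite n)) = (n : ℤ[X]) * hermite n := by
  cases n with
  | zero => simp
  | succ n =>
    have h : derivative ((n : ℤ[X]) + 1) = 0 := by simp
    rw [derivative_hermite_succ, derivative_mul, h, hermite_succ n]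
    push_cast
    ring

/-- The Hermite polynomials as complex polynomials. -/
def hermiteC (n : ℕ) : ℂ[X] := (hermite n).map (Int.castRingHom ℂ)

lemma hermiteC_zero : hermiteC 0 = 1 := by simp [hermiteC]

lemma hermiteC_succ (n : ℕ) : hermiteC (n + 1) = X * hermiteC n - derivative (hermiteC n) := by
  simp [hermiteC, hermite_succ, derivative_map]

lemma hermiteC_ode (n : ℕ) :
    X * derivative (hermiteC n) - derivative (derivative (hermiteC n)) =
    (n : ℂ[X]) * hermiteC n := by
  have h := congrArg (Polynomial.map (Int.castRingHom ℂ)) (hermite_ode n)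
  simpa [hermiteC, derivative_map] using h

lemma degree_hermiteC (n : ℕ) : (hermiteC n).degree = n := by
  rw [hermiteC, degree_map_eq_of_injective (RingHom.injective_int _), degree_hermite]

/-- The coefficients are integers. Reality turns the sesquilinear pairing with a ridge function into
a bilinear integral, to which integration by parts applies. -/
lemma star_eval_hermiteC (n : ℕ) (s : ℝ) :
    (starRingEnd ℂ) ((hermiteC n).eval (s : ℂ)) = (hermiteC n).eval (s : ℂ) := by
  have h : (hermiteC n).eval (s : ℂ) = (((hermite n).map (Int.castRingHom ℝ)).eval s : ℝ) := by
    rw [hermiteC, eval_map, eval_map, eval₂_eq_sum_range, eval₂_eq_sum_range]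
    simp
  rw [h, Complex.conj_ofReal]

lemma span_hermiteC : Submodule.span ℂ (Set.range hermiteC) = ⊤ := by
  let S : Polynomial.Sequence ℂ := ⟨hermiteC, degree_hermiteC⟩
  refine S.span fun i => ?_
  rw [isUnit_iff_ne_zero]
  exact leadingCoeff_ne_zero.2 (S.ne_zero i)

/-! ### Ridge functions -/

variable {d : ℕ}

local notation "𝔼" => EuclideanSpace ℝ (Fin d)

/-- The function `x ↦ P(⟨e, x⟩)`. -/
def ridge (P : ℂ[X]) (e : 𝔼) (x : 𝔼) : ℂ := P.eval ((inner ℝ e x : ℝ) : ℂ)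

lemma hasDerivAt_eval_ofReal (P : ℂ[X]) (s : ℝ) :
    HasDerivAt (fun s : ℝ => P.eval (s : ℂ)) (P.derivative.eval (s : ℂ)) s :=
  (P.hasDerivAt (s : ℂ)).comp_ofReal

lemma iteratedDeriv_eval_ofReal (P : ℂ[X]) (i : ℕ) :
    iteratedDeriv i (fun s : ℝ => P.eval (s : ℂ)) =
      fun s : ℝ => (derivative^[i] P).eval (s : ℂ) := by
  induction i with
  | zero => simp
  | succ i ih =>
    rw [iteratedDeriv_succ, ih]
    funext s
    rw [(hasDerivAt_eval_ofReal _ s).deriv, Function.iterate_succ_apply']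

lemma contDiff_eval_ofReal (P : ℂ[X]) : ContDiff ℝ 2 fun s : ℝ => P.eval (s : ℂ) := by
  have h : ContDiff ℝ 2 fun w : ℂ => P.eval w := by
    simpa using (P.contDiff_aeval (𝕜 := ℂ) 2).restrict_scalars ℝ
  exact h.comp Complex.ofRealCLM.contDiff

lemma ridge_eq_comp (P : ℂ[X]) (e : 𝔼) :
    ridge P e = (fun s : ℝ => P.eval (s : ℂ)) ∘ (innerSL ℝ e) := rfl

lemma expBounded_ridge (P : ℂ[X]) (e : 𝔼) : ExpBounded (ridge P e) := by
  unfold ridge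
  induction P using Polynomial.induction_on' with
  | add p q hp hq =>
    simp only [eval_add]
    exact hp.add hq
  | monomial n a =>
    simp only [eval_monomial]
    exact (expBounded_pow (expBounded_inner e) n).const_mul a

lemma iteratedFDeriv_ridge (P : ℂ[X]) (e x : 𝔼) {i : ℕ} (hi : i ≤ 2) :
    iteratedFDeriv ℝ i (ridge P e) x =
      (iteratedFDeriv ℝ i (fun s : ℝ => P.eval (s : ℂ)) (inner ℝ e x)).compContinuousLinearMap
        fun _ => innerSL ℝ e :=
  (innerSL ℝ e).iteratedFDeriv_comp_right (contDiff_eval_ofReal P) x (by exact_mod_cast hi)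

/-- The `i`-th derivative is the `i`-th derivative of `P` at `⟨e, x⟩` composed with the functional
`⟨e, ·⟩` in each slot, so it grows at most like a polynomial. -/
lemma tame_ridge (P : ℂ[X]) (e : 𝔼) : Tame (ridge P e) := by
  refine ⟨(contDiff_eval_ofReal P).comp (innerSL ℝ e).contDiff, fun i hi => ?_⟩
  obtain ⟨C, k, h⟩ := expBounded_ridge (derivative^[i] P) e
  refine ⟨C * ‖innerSL ℝ e‖ ^ i, k, fun x => ?_⟩
  simp only [iteratedFDeriv_ridge P e x hi]
  refine (ContinuousMultilinearMap.norm_compContinuousLinearMap_le _ _).trans ?_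
  rw [norm_iteratedFDeriv_eq_norm_iteratedDeriv, iteratedDeriv_eval_ofReal]
  simp only [Finset.prod_const, Finset.card_univ, Fintype.card_fin]
  calc ‖(derivative^[i] P).eval ((inner ℝ e x : ℝ) : ℂ)‖ * ‖innerSL ℝ e‖ ^ i ≤
        (C * Real.exp (k * ‖x‖)) * ‖innerSL ℝ e‖ ^ i := by
          gcongr
          exact h x
    _ = _ := by ring

lemma fderiv_ridge (P : ℂ[X]) (e x v : 𝔼) :
    fderiv ℝ (ridge P e) x v = (inner ℝ e v : ℝ) * ridge P.derivative e x := by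
  have h0 : HasDerivAt (fun s : ℝ => P.eval (s : ℂ)) (P.derivative.eval ((inner ℝ e x : ℝ) : ℂ))
      (innerSL ℝ e x) := hasDerivAt_eval_ofReal P (inner ℝ e x)
  have h := h0.hasFDerivAt.comp x (innerSL ℝ e).hasFDerivAt
  rw [ridge_eq_comp, h.fderiv]
  simp [ridge]

lemma ouExpr_ridge (P : ℂ[X]) (e x : 𝔼) :
    ouExpr (ridge P e) x = (inner ℝ e x : ℝ) * ridge P.derivative e x
      - ‖e‖ ^ 2 * ridge (derivative (derivative P)) e x := by
  have h1 : ∀ v : 𝔼, iteratedFDeriv ℝ 2 (ridge P e) x ![v, v] =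
      ((inner ℝ e v : ℝ) ^ 2 : ℂ) * ridge (derivative (derivative P)) e x := by
    intro v
    have h2 : ∀ y, fderiv ℝ (ridge P e) y v = (inner ℝ e v : ℝ) * ridge P.derivative e y :=
      fun y => fderiv_ridge P e y v
    have hdd : DifferentiableAt ℝ (fderiv ℝ (ridge P e)) x :=
      ((tame_ridge P e).contDiff.fderiv_right (m := 1) (by norm_num)).differentiable one_ne_zero x
    have h3 : fderiv ℝ (fun y => fderiv ℝ (ridge P e) y v) x v =
        iteratedFDeriv ℝ 2 (ridge P e) x ![v, v] := by
      rw [iteratedFDeriv_two_apply, fderiv_clm_apply hdd (differentiableAt_const v)]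
      simp
    rw [← h3]
    simp only [h2]
    rw [fderiv_const_mul ((tame_ridge _ e).contDiff.differentiable two_ne_zero x)]
    simp only [smul_apply, fderiv_ridge, smul_eq_mul]
    ring
  rw [ouExpr, InnerProductSpace.laplacian_eq_iteratedFDeriv_orthonormalBasis _
    (EuclideanSpace.basisFun (Fin d) ℝ)]
  simp only [h1]
  rw [← Finset.sum_mul, fderiv_ridge]
  have h4 := (EuclideanSpace.basisFun (Fin d) ℝ).sum_sq_inner_left e
  have h5 : (∑ i, ((inner ℝ e (EuclideanSpace.basisFun (Fin d) ℝ i) : ℝ) ^ 2 : ℂ)) = ‖e‖ ^ 2 := by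
    exact_mod_cast h4
  rw [h5]
  ring

/-- The indices `(n, e)` of the ridge eigenfunctions: unit vectors, or arbitrary vectors for the
constant function. -/
def RidgeIndex (n : ℕ) (e : 𝔼) : Prop := ‖e‖ = 1 ∨ n = 0

lemma ouExpr_ridge_hermiteC {n : ℕ} {e : 𝔼} (he : RidgeIndex n e) :
    ouExpr (ridge (hermiteC n) e) = fun x => n * ridge (hermiteC n) e x := by
  funext x
  rw [ouExpr_ridge]
  rcases he with he | rfl
  · have h := congrArg (eval ((inner ℝ e x : ℝ) : ℂ)) (hermiteC_ode n)
    simp only [eval_sub, eval_mul, eval_X, eval_natCast] at h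
    simp only [ridge, he, ← h]
    simp
  · simp [hermiteC_zero, ridge]

/-- The ridge eigenfunction `x ↦ Hₙ(⟨e, x⟩)` as an element of `L²(γ)`. -/
def hermiteRidge (n : ℕ) (e : 𝔼) : GaussL2 d := (tame_ridge (hermiteC n) e).memLp.toLp _

lemma coeFn_hermiteRidge (n : ℕ) (e : 𝔼) :
    hermiteRidge n e =ᵐ[gaussianRd d] ridge (hermiteC n) e := MemLp.coeFn_toLp _

lemma hermiteRidge_mem_closure {n : ℕ} {e : 𝔼} (he : RidgeIndex n e) :
    (hermiteRidge n e, (n : ℂ) • hermiteRidge n e) ∈ (ouTestGraph d).topologicalClosure := by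
  have h : (n : ℂ) • hermiteRidge n e = (tame_ridge (hermiteC n) e).memLp_ouExpr.toLp _ := by
    refine (MemLp.toLp_const_smul (n : ℂ) (tame_ridge (hermiteC n) e).memLp).symm.trans
      (MemLp.toLp_congr _ _ (ae_of_all _ fun x => ?_))
    rw [ouExpr_ridge_hermiteC he]
    rfl
  rw [h]
  exact (tame_ridge (hermiteC n) e).mem_closure_ouTestGraph

lemma inner_hermiteRidge (n : ℕ) (e : 𝔼) (f : GaussL2 d) :
    inner ℂ (hermiteRidge n e) f = ∫ x, ridge (hermiteC n) e x * f x ∂(gaussianRd d) := by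
  rw [L2.inner_def]
  refine integral_congr_ae ?_
  filter_upwards [coeFn_hermiteRidge n e] with x hx
  rw [hx, RCLike.inner_apply, ridge, star_eval_hermiteC, mul_comm]

/-- Symmetry moves the operator onto the ridge function. This weak eigenvalue relation is closed in
`u`, so it passes to the closure of the graph. -/
lemma inner_hermiteRidge_ouTestGraph {n : ℕ} {e : 𝔼} (he : RidgeIndex n e)
    {u : GaussL2 d × GaussL2 d} (hu : u ∈ ouTestGraph d) :
    inner ℂ (hermiteRidge n e) u.2 = n * inner ℂ (hermiteRidge n e) u.1 := by
  obtain ⟨f, hf, hfc, h1, h2⟩ := hu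
  rw [inner_hermiteRidge, inner_hermiteRidge]
  calc _ = ∫ x, ridge (hermiteC n) e x * ouExpr f x ∂(gaussianRd d) :=
        integral_congr_ae (h2.mono fun x hx => by simp only [hx])
    _ = ∫ x, n * (ridge (hermiteC n) e x * f x) ∂(gaussianRd d) := by
      rw [integral_mul_ouExpr_comm (tame_ridge _ e) (tame_of_hasCompactSupport hf hfc),
        ouExpr_ridge_hermiteC he]
      simp only [mul_assoc]
    _ = n * ∫ x, ridge (hermiteC n) e x * f x ∂(gaussianRd d) := integral_const_mul _ _
    _ = _ := by
      congr 1
      exact integral_congr_ae (h1.mono fun x hx => by simp only [hx])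

/-! ### Completeness of the eigenfunctions -/

/-- An integrable function with vanishing Fourier transform is zero. -/
lemma ae_eq_zero_of_forall_integral_exp {F : 𝔼 → ℂ} (hF : Integrable F)
    (h : ∀ ξ : 𝔼, ∫ x, Complex.exp ((inner ℝ ξ x : ℝ) * Complex.I) * F x = 0) :
    ∀ᵐ x, F x = 0 := by
  refine ae_eq_zero_of_integral_contDiff_smul_eq_zero hF.locallyIntegrable fun g hg hgc => ?_
  let G : SchwartzMap 𝔼 ℂ := HasCompactSupport.toSchwartzMap (f := fun x => (g x : ℂ))
    (hgc.comp_left (g := fun r : ℝ => (r : ℂ)) Complex.ofReal_zero)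
    (Complex.ofRealCLM.contDiff.comp hg)
  let u : SchwartzMap 𝔼 ℂ := FourierTransform.fourierInv G
  have hu : FourierTransform.fourier u = G := FourierTransform.fourier_fourierInv_eq G
  -- Multiplication formula `∫ F̂ u = ∫ F û`, with the Schwartz function `u` chosen so that `û` is
  -- the test function `g`.
  have key := VectorFourier.integral_fourierIntegral_smul_eq_flip (L := innerₗ 𝔼)
    (μ := volume) (ν := volume) Real.continuous_fourierChar continuous_inner hF u.integrable
  have h0 : ∀ ξ, VectorFourier.fourierIntegral Real.fourierChar volume (innerₗ 𝔼) F ξ = 0 := by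
    intro ξ
    rw [VectorFourier.fourierIntegral, ← h (-(2 * Real.pi) • ξ)]
    refine integral_congr_ae (ae_of_all _ fun x => ?_)
    simp only [Circle.smul_def, Real.fourierChar_apply, innerₗ_apply_apply, smul_eq_mul,
      inner_smul_left, real_inner_comm ξ x]
    congr 3
    simp
  have h1 : ∀ x, VectorFourier.fourierIntegral Real.fourierChar volume (innerₗ 𝔼).flip u x =
      g x := by
    intro x
    have h2 : (FourierTransform.fourier u : SchwartzMap 𝔼 ℂ) x = g x := by
      rw [hu]
      rfl
    rw [← h2, SchwartzMap.fourier_coe, flip_innerₗ]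
    rfl
  simp only [h0, h1, zero_smul, integral_zero] at key
  rw [key]
  refine integral_congr_ae (ae_of_all _ fun x => ?_)
  simp [mul_comm]

/-- The characters form a complete system in `L²(γ)`. -/
lemma eq_zero_of_forall_integral_exp {f : GaussL2 d}
    (h : ∀ ξ : 𝔼, ∫ x, Complex.exp ((inner ℝ ξ x : ℝ) * Complex.I) * f x ∂(gaussianRd d) = 0) :
    f = 0 := by
  have hint : Integrable (fun x => (gaussDensity d x : ℂ) * f x) := by
    have h1 := integrable_gaussianRd_iff.1 ((Lp.memLp f).integrable (by norm_num))
    simpa using h1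
  have h0 := ae_eq_zero_of_forall_integral_exp hint fun ξ => by
    have h1 := h ξ
    rw [integral_gaussianRd] at h1
    simpa only [mul_left_comm] using h1
  refine Lp.ext ?_
  refine EventuallyEq.trans ?_ (Lp.coeFn_zero _ _ _).symm
  have hac : gaussianRd d ≪ volume := withDensity_absolutelyContinuous _ _
  filter_upwards [hac.ae_le h0] with x hx
  simpa [(gaussDensity_pos x).ne'] using hx

lemma integrable_mul_of_expBounded {h : 𝔼 → ℂ} (hh : ExpBounded h) (hc : Continuous h)
    (f : GaussL2 d) : Integrable (fun x => h x * f x) (gaussianRd d) :=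
  (hh.memLp_two hc.aestronglyMeasurable).integrable_mul (Lp.memLp f)

/-- The ridge eigenfunctions form a complete system in `L²(γ)`. -/
lemma eq_zero_of_forall_inner_hermiteRidge {f : GaussL2 d}
    (h : ∀ n, ∀ e : 𝔼, RidgeIndex n e → inner ℂ (hermiteRidge n e) f = 0) : f = 0 := by
  -- In a fixed direction the Hermite polynomials span all polynomials, in particular the powers
  -- needed in the exponential series below.
  have hridge : ∀ (e : 𝔼), ‖e‖ = 1 → ∀ P : ℂ[X], ∫ x, ridge P e x * f x ∂(gaussianRd d) = 0 := by
    intro e he P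
    have hint : ∀ Q : ℂ[X], Integrable (fun x => ridge Q e x * f x) (gaussianRd d) := fun Q =>
      integrable_mul_of_expBounded (expBounded_ridge Q e) (tame_ridge Q e).contDiff.continuous f
    have hP : P ∈ Submodule.span ℂ (Set.range hermiteC) := by
      rw [span_hermiteC]
      trivial
    induction hP using Submodule.span_induction with
    | mem Q hQ =>
      obtain ⟨n, rfl⟩ := hQ
      rw [← inner_hermiteRidge]
      exact h n e (.inl he)
    | zero => simp [ridge]
    | add Q R _ _ hQ hR =>
      have h1 := integral_add (hint Q) (hint R)
      rw [hQ, hR, add_zero] at h1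
      rw [← h1]
      refine integral_congr_ae (ae_of_all _ fun x => ?_)
      simp [ridge, add_mul]
    | smul a Q _ hQ =>
      have h1 := integral_const_mul (μ := gaussianRd d) a fun x => ridge Q e x * f x
      rw [hQ, mul_zero] at h1
      rw [← h1]
      refine integral_congr_ae (ae_of_all _ fun x => ?_)
      simp [ridge, mul_assoc]
  refine eq_zero_of_forall_integral_exp fun ξ => ?_
  -- A zero frequency has no direction and is tested by the constant function; this also covers `d =
  -- 0`, where there are no unit vectors.
  by_cases hξ : ξ = 0
  · have h1 := h 0 0 (.inr rfl)
    rw [inner_hermiteRidge] at h1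
    rw [← h1]
    refine integral_congr_ae (ae_of_all _ fun x => ?_)
    simp [hξ, ridge, hermiteC_zero]
  have hξ' : ‖ξ‖ ≠ 0 := norm_ne_zero_iff.2 hξ
  set e : 𝔼 := ‖ξ‖⁻¹ • ξ with he
  have he1 : ‖e‖ = 1 := norm_smul_inv_norm (𝕜 := ℝ) hξ
  have hξe : ξ = ‖ξ‖ • e := by rw [he, smul_smul, mul_inv_cancel₀ hξ', one_smul]
  set t : ℝ := ‖ξ‖
  -- Termwise integration of the series of `exp(i t⟨e, x⟩)`, dominated by `exp(t|x|) |f|`, which is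
  -- integrable as a product of two `L²(γ)` functions.
  have hsum := hasSum_integral_of_dominated_convergence (μ := gaussianRd d)
    (F := fun (n : ℕ) x => ridge (C ((t * Complex.I) ^ n / (n.factorial : ℂ)) * X ^ n) e x * f x)
    (f := fun x => Complex.exp ((inner ℝ ξ x : ℝ) * Complex.I) * f x)
    (fun n x => (t * ‖x‖) ^ n / n.factorial * ‖f x‖) (fun n => ?_) (fun n => ?_) ?_ ?_ ?_
  · simp only [hridge e he1] at hsum
    exact (hasSum_zero.unique hsum).symm
  · exact (tame_ridge _ e).contDiff.continuous.aestronglyMeasurable.mul (Lp.aestronglyMeasurable f)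
  · refine ae_of_all _ fun x => ?_
    rw [norm_mul]
    gcongr
    simp only [ridge, eval_mul, eval_C, eval_pow, eval_X, norm_mul, norm_div, norm_pow,
      Complex.norm_real, Complex.norm_I, Complex.norm_natCast, mul_pow, one_pow, mul_one]
    rw [Real.norm_of_nonneg (show 0 ≤ t from norm_nonneg ξ), div_mul_eq_mul_div]
    have h2 := norm_inner_le_norm (𝕜 := ℝ) e x
    rw [he1, one_mul] at h2
    gcongr
  · exact ae_of_all _ fun x => (Real.summable_pow_div_factorial _).mul_right _
  · have h2 : ∀ x : 𝔼, ∑' n : ℕ, (t * ‖x‖) ^ n / n.factorial * ‖f x‖ =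
        Real.exp (t * ‖x‖) * ‖f x‖ := fun x => by
      rw [tsum_mul_right, Real.exp_eq_exp_ℝ, NormedSpace.exp_eq_tsum_div]
    simp only [h2]
    have h3 : ExpBounded fun x : 𝔼 => Real.exp (t * ‖x‖) := ⟨1, t, fun x => by simp⟩
    exact (h3.memLp_two (by fun_prop)).integrable_mul (Lp.memLp f).norm
  · refine ae_of_all _ fun x => ?_
    have h2 := (NormedSpace.expSeries_div_hasSum_exp (𝔸 := ℂ)
      ((inner ℝ ξ x : ℝ) * Complex.I)).mul_right
      (f x)
    rw [← Complex.exp_eq_exp_ℂ] at h2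
    have h3 : ∀ n : ℕ, ridge (C ((t * Complex.I) ^ n / (n.factorial : ℂ)) * X ^ n) e x * f x =
        ((inner ℝ ξ x : ℝ) * Complex.I) ^ n / n.factorial * f x := fun n => by
      simp only [ridge, eval_mul, eval_C, eval_pow, eval_X]
      have h4 : (inner ℝ ξ x : ℝ) = t * inner ℝ e x := by
        conv_lhs => rw [hξe, real_inner_smul_left]
      rw [h4]
      push_cast
      ring
    simp only [h3]
    exact h2

end Hermite

/-- A complete orthogonal family of subspaces has an adapted Hilbert basis. -/
lemma OrthogonalFamily.exists_hilbertBasis_mem {H : Type} [NormedAddCommGroup H]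
    [InnerProductSpace ℂ H] [CompleteSpace H] {κ : Type} {K : κ → Submodule ℂ H}
    [∀ n, CompleteSpace (K n)]
    (hK : OrthogonalFamily ℂ (fun n => K n) fun n => (K n).subtypeₗᵢ)
    (htotal : ∀ f, (∀ n, ∀ u ∈ K n, inner ℂ u f = 0) → f = 0) :
    ∃ (ι : Type) (deg : ι → κ) (b : HilbertBasis ι ℂ H), ∀ i, b i ∈ K (deg i) := by
  choose w b _ using fun n => exists_hilbertBasis ℂ (K n)
  have hon : Orthonormal ℂ fun a : Σ n, w n => ((b a.1 a.2 : K a.1) : H) :=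
    hK.orthonormal_sigma_orthonormal fun n => (b n).orthonormal
  refine ⟨Σ n, w n, fun a => a.1, HilbertBasis.mkOfOrthogonalEqBot hon ?_, fun a => ?_⟩
  · rw [Submodule.eq_bot_iff]
    intro f hf
    refine htotal f fun n u hu => ?_
    -- A vector orthogonal to the whole family is orthogonal to the basis of each `K n`, so all its
    -- projections vanish and totality applies.
    have h0 : (K n).orthogonalProjectionOnto f = 0 := by
      refine (b n).ext_repr fun i => ?_
      rw [(b n).repr_apply_apply]
      have h1 := Submodule.inner_orthogonalProjectionOnto_eq_of_mem_left (b n i) f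
      rw [h1]
      have h2 := (Submodule.mem_orthogonal _ _).1 hf _ (Submodule.subset_span ⟨⟨n, i⟩, rfl⟩)
      simpa using h2
    have h1 := Submodule.inner_orthogonalProjectionOnto_eq_of_mem_left (⟨u, hu⟩ : K n) f
    rw [h0] at h1
    simpa using h1.symm
  · rw [HilbertBasis.coe_mkOfOrthogonalEqBot]
    exact (b a.1 a.2).2

section Spectral

open Polynomial

variable {d : ℕ}

local notation "𝔼" => EuclideanSpace ℝ (Fin d)

/-! ### The eigenspaces -/

/-- The eigenspace of the Ornstein--Uhlenbeck operator for the eigenvalue `n`. -/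
def hermiteSpace (d n : ℕ) : Submodule ℂ (GaussL2 d) :=
  (Submodule.span ℂ {u | ∃ e, RidgeIndex n e ∧ hermiteRidge n e = u}).topologicalClosure

lemma hermiteSpace_le {n : ℕ} {K : Submodule ℂ (GaussL2 d)} (hK : IsClosed (K : Set (GaussL2 d)))
    (h : ∀ e, RidgeIndex n e → hermiteRidge n e ∈ K) : hermiteSpace d n ≤ K := by
  refine Submodule.topologicalClosure_minimal _ (Submodule.span_le.2 ?_) hK
  rintro _ ⟨e, he, rfl⟩
  exact h e he

lemma hermiteRidge_mem {n : ℕ} {e : 𝔼} (he : RidgeIndex n e) :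
    hermiteRidge n e ∈ hermiteSpace d n :=
  Submodule.le_topologicalClosure _ (Submodule.subset_span ⟨e, he, rfl⟩)

instance (n : ℕ) : CompleteSpace (hermiteSpace d n) :=
  (Submodule.isClosed_topologicalClosure _).completeSpace_coe

lemma mem_closure_of_mem_hermiteSpace {n : ℕ} {u : GaussL2 d} (hu : u ∈ hermiteSpace d n) :
    (u, (n : ℂ) • u) ∈ (ouTestGraph d).topologicalClosure := by
  let T : GaussL2 d →L[ℂ] GaussL2 d × GaussL2 d :=
    (ContinuousLinearMap.id ℂ _).prod ((n : ℂ) • ContinuousLinearMap.id ℂ _)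
  have h : hermiteSpace d n ≤
      (ouTestGraph d).topologicalClosure.comap (T : GaussL2 d →ₗ[ℂ] GaussL2 d × GaussL2 d) :=
    hermiteSpace_le ((Submodule.isClosed_topologicalClosure _).preimage T.continuous)
      fun e he => hermiteRidge_mem_closure he
  exact h hu

/-- Two closure arguments: the relation is closed in `v` for each ridge function, and then closed
and linear in `u` for fixed `v`, being orthogonality to `v.2 - n v.1`. -/
lemma inner_eq_of_mem_closure {n : ℕ} {u : GaussL2 d} (hu : u ∈ hermiteSpace d n)
    {v : GaussL2 d × GaussL2 d} (hv : v ∈ (ouTestGraph d).topologicalClosure) :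
    inner ℂ u v.2 = n * inner ℂ u v.1 := by
  have h : hermiteSpace d n ≤ (Submodule.span ℂ {v.2 - (n : ℂ) • v.1})ᗮ := by
    refine hermiteSpace_le (Submodule.isClosed_orthogonal _) fun e he => ?_
    rw [Submodule.mem_orthogonal_singleton_iff_inner_left, inner_sub_right, inner_smul_right,
      sub_eq_zero]
    have hcl : IsClosed {v : GaussL2 d × GaussL2 d |
        inner ℂ (hermiteRidge n e) v.2 = n * inner ℂ (hermiteRidge n e) v.1} :=
      isClosed_eq (by fun_prop) (by fun_prop)
    exact closure_minimal (fun w hw => inner_hermiteRidge_ouTestGraph he hw) hcl hv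
  have h1 := h hu
  rw [Submodule.mem_orthogonal_singleton_iff_inner_left, inner_sub_right, inner_smul_right,
    sub_eq_zero] at h1
  exact h1

/-- The usual argument for a symmetric operator: pairing with the image of an eigenvector yields
either eigenvalue. -/
lemma orthogonalFamily_hermiteSpace (d : ℕ) :
    OrthogonalFamily ℂ (fun n => hermiteSpace d n) fun n => (hermiteSpace d n).subtypeₗᵢ := by
  intro m n hmn u v
  have h := inner_eq_of_mem_closure u.2 (mem_closure_of_mem_hermiteSpace v.2)
  simp only [inner_smul_right] at h
  rw [← sub_eq_zero, ← sub_mul] at h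
  refine (mul_eq_zero.1 h).resolve_left (sub_ne_zero.2 ?_)
  exact_mod_cast hmn.symm

/-- There is a Hilbert basis of `L²(γ)` that consists of eigenfunctions. -/
lemma exists_hermiteBasis (d : ℕ) : ∃ (ι : Type) (deg : ι → ℕ) (b : HilbertBasis ι ℂ (GaussL2 d)),
    ∀ i, b i ∈ hermiteSpace d (deg i) :=
  (orthogonalFamily_hermiteSpace d).exists_hilbertBasis_mem fun _ hf =>
    eq_zero_of_forall_inner_hermiteRidge fun n _ he => hf n _ (hermiteRidge_mem he)

/-! ### The Ornstein--Uhlenbeck operator is diagonal -/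

variable {ι : Type} {deg : ι → ℕ} {b : HilbertBasis ι ℂ (GaussL2 d)}

/-- Forward, this is the weak eigenvalue relation. Backward, the partial sums of the expansions of
`u` and `w` form pairs in the closed graph that converge to `(u, w)`: thus `C_c²` is a core of the
maximal diagonal operator. -/
lemma mem_closure_ouTestGraph_iff (hb : ∀ i, b i ∈ hermiteSpace d (deg i)) (u w : GaussL2 d) :
    (u, w) ∈ (ouTestGraph d).topologicalClosure ↔ ∀ i, b.repr w i = deg i * b.repr u i := by
  constructor
  · intro h i
    rw [b.repr_apply_apply, b.repr_apply_apply]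
    exact inner_eq_of_mem_closure (hb i) h
  · intro h
    have h1 := (b.hasSum_repr u).prodMk (b.hasSum_repr w)
    refine (Submodule.isClosed_topologicalClosure (ouTestGraph d)).mem_of_tendsto h1
      (Eventually.of_forall fun s => Submodule.sum_mem _ fun i _ => ?_)
    have h2 := Submodule.smul_mem _ (b.repr u i) (mem_closure_of_mem_hermiteSpace (hb i))
    convert h2 using 1
    rw [Prod.smul_mk, h i, smul_smul, mul_comm]

/-- `LinearPMap.closure` has this graph only for closable operators. Closability is read off in
coordinates: `u = 0` forces every coordinate of `w` to vanish. -/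
lemma graph_ouOperator (d : ℕ) : (ouOperator d).graph = (ouTestGraph d).topologicalClosure := by
  obtain ⟨ι, deg, b, hb⟩ := exists_hermiteBasis d
  have hcl : (ouTest d).IsClosable := by
    refine ⟨(ouTestGraph d).topologicalClosure.toLinearPMap, ?_⟩
    rw [ouTest_graph, Submodule.toLinearPMap_graph_eq]
    rintro ⟨u, w⟩ h (rfl : u = 0)
    refine b.ext_repr fun i => ?_
    rw [(mem_closure_ouTestGraph_iff hb _ _).1 h i]
    simp
  rw [ouOperator, ← hcl.graph_closure_eq_closure_graph, ouTest_graph]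

lemma mem_graph_smul_ouOperator_iff (hb : ∀ i, b i ∈ hermiteSpace d (deg i)) {z : ℂ} (hz : z ≠ 0)
    (u w : GaussL2 d) :
    (u, w) ∈ ((-z) • ouOperator d).graph ↔
      ∀ i, b.repr w i = -z * (((deg i : ℝ) : ℂ) * b.repr u i) := by
  rw [LinearPMap.smul_graph, Submodule.mem_map, graph_ouOperator]
  constructor
  · rintro ⟨⟨u', w'⟩, h, he⟩ i
    obtain ⟨rfl, rfl⟩ := Prod.mk.inj he
    have h1 := (mem_closure_ouTestGraph_iff hb _ _).1 h i
    change b.repr ((-z) • w') i = -z * (((deg i : ℝ) : ℂ) * b.repr u' i)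
    rw [map_smul, lp.coeFn_smul, Pi.smul_apply, h1, smul_eq_mul, Complex.ofReal_natCast]
  · intro h
    refine ⟨(u, (-z)⁻¹ • w), (mem_closure_ouTestGraph_iff hb _ _).2 fun i => ?_, ?_⟩
    · rw [map_smul, lp.coeFn_smul, Pi.smul_apply, h i, smul_eq_mul, ← mul_assoc,
        inv_mul_cancel₀ (neg_ne_zero.2 hz)]
      simp
    · refine Prod.ext rfl ?_
      change (-z) • (-z)⁻¹ • w = w
      rw [smul_smul, mul_inv_cancel₀ (neg_ne_zero.2 hz), one_smul]

/-! ### The semigroup -/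

lemma isExpNegOU_expSemigroup (hb : ∀ i, b i ∈ hermiteSpace d (deg i)) {z : ℂ} (hz : 0 < z.re) :
    IsExpNegOU z (b.expSemigroup (fun i => (deg i : ℝ)) (fun _ => Nat.cast_nonneg _) z hz 1) := by
  have hz0 : z ≠ 0 := fun h => by simp [h] at hz
  exact ⟨_, b.isSemigroupGeneratedBy_expSemigroup _ _ z hz
    (mem_graph_smul_ouOperator_iff hb hz0), rfl⟩

/-- Both semigroups have the same generator, so they agree on its eigenvectors `b i`, whose span is
dense. -/
lemma IsExpNegOU.eq_expSemigroup (hb : ∀ i, b i ∈ hermiteSpace d (deg i)) {z : ℂ} (hz : 0 < z.re)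
    {V : GaussL2 d →L[ℂ] GaussL2 d} (hV : IsExpNegOU z V) :
    V = b.expSemigroup (fun i => (deg i : ℝ)) (fun _ => Nat.cast_nonneg _) z hz 1 := by
  have hz0 : z ≠ 0 := fun h => by simp [h] at hz
  obtain ⟨S, hS, rfl⟩ := hV
  have hS' := b.isSemigroupGeneratedBy_expSemigroup (fun i => (deg i : ℝ))
    (fun _ => Nat.cast_nonneg _) z hz (mem_graph_smul_ouOperator_iff hb hz0)
  have hdense : Dense (Submodule.span ℂ (Set.range b) : Set (GaussL2 d)) :=
    Submodule.dense_iff_topologicalClosure_eq_top.2 b.dense_span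
  refine ContinuousLinearMap.ext_on hdense ?_
  rintro _ ⟨i, rfl⟩
  have hi : (b i, (-z * deg i) • b i) ∈ ((-z) • ouOperator d).graph := by
    rw [mem_graph_smul_ouOperator_iff hb hz0]
    intro j
    rw [map_smul, lp.coeFn_smul, Pi.smul_apply, smul_eq_mul]
    by_cases hij : i = j
    · subst hij
      push_cast
      ring
    · have h0 : b.repr (b i) j = 0 := by
        rw [b.repr_apply_apply]
        exact b.orthonormal.2 (Ne.symm hij)
      simp [h0]
  rw [hS.apply_eigenvector hi zero_le_one, hS'.apply_eigenvector hi zero_le_one]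

/-- Existence and uniqueness of `exp(-zL)`. -/
lemma existsUnique_isExpNegOU (d : ℕ) {z : ℂ} (hz : 0 < z.re) :
    ∃! V : GaussL2 d →L[ℂ] GaussL2 d, IsExpNegOU z V := by
  obtain ⟨ι, deg, b, hb⟩ := exists_hermiteBasis d
  exact ⟨_, isExpNegOU_expSemigroup hb hz, fun V hV => hV.eq_expSemigroup hb hz⟩

/-! ### The action on exponentials -/

/-- The exponential function `exp(c⟨η, x⟩ - c²|η|²/2)`. -/
def gaussExp (c : ℂ) (η x : 𝔼) : ℂ :=
  Complex.exp (c * (inner ℝ η x : ℝ) - c ^ 2 * ‖η‖ ^ 2 / 2)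

lemma contDiff_gaussExp (c : ℂ) (η : 𝔼) : ContDiff ℝ 1 (gaussExp c η) := by
  have h : ContDiff ℝ 1 fun x : 𝔼 => ((inner ℝ η x : ℝ) : ℂ) :=
    Complex.ofRealCLM.contDiff.comp (innerSL ℝ η).contDiff
  exact ((contDiff_const.mul h).sub contDiff_const).cexp

lemma expBounded_gaussExp (c : ℂ) (η : 𝔼) : ExpBounded (gaussExp c η) := by
  refine ⟨Real.exp ‖c ^ 2 * ‖η‖ ^ 2 / 2‖, ‖c‖ * ‖η‖, fun x => ?_⟩
  rw [gaussExp, Complex.norm_exp, ← Real.exp_add, Real.exp_le_exp]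
  refine (Complex.re_le_norm _).trans ((norm_sub_le _ _).trans ?_)
  rw [norm_mul, Complex.norm_real, add_comm, mul_assoc]
  gcongr
  exact norm_inner_le_norm η x

lemma fderiv_gaussExp (c : ℂ) (η x v : 𝔼) :
    fderiv ℝ (gaussExp c η) x v = c * (inner ℝ η v : ℝ) * gaussExp c η x := by
  have h : HasFDerivAt (fun x : 𝔼 => ((inner ℝ η x : ℝ) : ℂ))
      (Complex.ofRealCLM.comp (innerSL ℝ η)) x :=
    Complex.ofRealCLM.hasFDerivAt.comp x (innerSL ℝ η).hasFDerivAt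
  have h1 : HasFDerivAt (gaussExp c η) _ x :=
    ((h.const_mul c).sub_const (c ^ 2 * ‖η‖ ^ 2 / 2)).cexp
  rw [h1.fderiv]
  simp [gaussExp]
  ring

lemma two_pi_rpow_mul_cpow (d : ℕ) :
    (((2 * Real.pi) ^ (-(d : ℝ) / 2) : ℝ) : ℂ) * (2 * Real.pi : ℂ) ^ ((d : ℂ) / 2) = 1 := by
  rw [Complex.ofReal_cpow (by positivity)]
  push_cast
  have h : (2 * Real.pi : ℂ) ≠ 0 := by
    norm_num [Real.pi_ne_zero]
  rw [← Complex.cpow_add _ _ h, neg_div, neg_add_cancel, Complex.cpow_zero]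

lemma integral_gaussExp (c : ℂ) (η : 𝔼) : ∫ x, gaussExp c η x ∂(gaussianRd d) = 1 := by
  rw [integral_gaussianRd]
  have h := GaussianFourier.integral_cexp_neg_mul_sq_norm_add (V := 𝔼) (b := 1 / 2)
    (by norm_num) c η
  have h1 : ∀ x : 𝔼, (gaussDensity d x : ℂ) * gaussExp c η x =
      ((((2 * Real.pi) ^ (-(d : ℝ) / 2) : ℝ) : ℂ) * Complex.exp (-(c ^ 2 * ‖η‖ ^ 2 / 2))) *
        Complex.exp (-(1 / 2) * ‖x‖ ^ 2 + c * (inner ℝ η x : ℝ)) := fun x => by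
    rw [gaussDensity, gaussExp, mul_assoc, ← Complex.exp_add, Complex.ofReal_mul,
      Complex.ofReal_exp, mul_assoc, ← Complex.exp_add]
    push_cast
    ring_nf
  simp only [h1]
  rw [integral_const_mul, h, finrank_euclideanSpace_fin]
  have h2 : (Real.pi / (1 / 2) : ℂ) = 2 * Real.pi := by ring
  rw [h2, mul_mul_mul_comm, two_pi_rpow_mul_cpow, ← Complex.exp_add, one_mul,
    Complex.exp_eq_one_iff]
  refine ⟨0, ?_⟩
  push_cast
  ring

/-- Integration by parts along `e` combined with the recursion for `Hₙ₊₁` cancels the `Hₙ'` terms,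
and each step contributes one factor `c⟨e, η⟩` from differentiating the exponential. -/
lemma integral_ridge_hermiteC_mul_gaussExp {n : ℕ} {e : 𝔼} (he : ‖e‖ = 1) (c : ℂ) (η : 𝔼) :
    ∫ x, ridge (hermiteC n) e x * gaussExp c η x ∂(gaussianRd d) = (c * (inner ℝ e η : ℝ)) ^ n := by
  induction n with
  | zero => simpa [hermiteC_zero, ridge] using integral_gaussExp c η
  | succ n ih =>
    have hE := expBounded_gaussExp c η
    have hP := expBounded_ridge (hermiteC n) e
    have hP' := expBounded_ridge (derivative (hermiteC n)) e
    have hcE := (contDiff_gaussExp c η).continuous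
    have hcP := (tame_ridge (hermiteC n) e).contDiff.continuous
    have hcP' := (tame_ridge (derivative (hermiteC n)) e).contDiff.continuous
    have hD : ∀ x, fderiv ℝ (fun x => ridge (hermiteC n) e x * gaussExp c η x) x e =
        ridge (derivative (hermiteC n)) e x * gaussExp c η x +
          c * (inner ℝ e η : ℝ) * (ridge (hermiteC n) e x * gaussExp c η x) := by
      intro x
      rw [fderiv_fun_mul ((tame_ridge (hermiteC n) e).contDiff.differentiable two_ne_zero x)
        ((contDiff_gaussExp c η).differentiable one_ne_zero x)]
      simp only [add_apply, smul_apply, fderiv_ridge,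
        fderiv_gaussExp, smul_eq_mul, real_inner_self_eq_norm_sq, he, real_inner_comm e η]
      push_cast
      ring
    have hi1 : Integrable (fun x => ridge (derivative (hermiteC n)) e x * gaussExp c η x)
        (gaussianRd d) := (hP'.mul hE).integrable (hcP'.mul hcE).aestronglyMeasurable
    have hi2 : Integrable (fun x => ridge (hermiteC n) e x * gaussExp c η x)
        (gaussianRd d) := (hP.mul hE).integrable (hcP.mul hcE).aestronglyMeasurable
    have hi3 : Integrable (fun x => ridge (hermiteC n) e x * gaussExp c η x * (inner ℝ e x : ℝ))
        (gaussianRd d) := ((hP.mul hE).mul (expBounded_inner e)).integrable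
          ((hcP.mul hcE).mul (by fun_prop)).aestronglyMeasurable
    have h := integral_fderiv_gaussianRd e
      (((tame_ridge (hermiteC n) e).contDiff.of_le (by norm_num)).mul (contDiff_gaussExp c η))
      (hP.mul hE) (by
        simp only [hD]
        exact (hP'.mul hE).add ((hP.mul hE).const_mul _))
    simp only [hD] at h
    rw [integral_add hi1 (hi2.const_mul _), integral_const_mul, ih, add_comm,
      ← eq_sub_iff_add_eq, ← integral_sub hi3 hi1] at h
    rw [pow_succ', h]
    refine integral_congr_ae (ae_of_all _ fun x => ?_)
    simp only [ridge, hermiteC_succ, eval_sub, eval_mul, eval_X]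
    ring

/-- `gaussExp` as an element of `L²(γ)`. -/
def gaussExpL2 (c : ℂ) (η : 𝔼) : GaussL2 d :=
  ((expBounded_gaussExp c η).memLp_two
    (contDiff_gaussExp c η).continuous.aestronglyMeasurable).toLp _

lemma coeFn_gaussExpL2 (c : ℂ) (η : 𝔼) : gaussExpL2 c η =ᵐ[gaussianRd d] gaussExp c η :=
  MemLp.coeFn_toLp _

lemma inner_hermiteRidge_gaussExpL2 {n : ℕ} {e : 𝔼} (he : RidgeIndex n e) (c : ℂ) (η : 𝔼) :
    inner ℂ (hermiteRidge n e) (gaussExpL2 c η) = (c * (inner ℝ e η : ℝ)) ^ n := by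
  rw [inner_hermiteRidge]
  have h : ∫ x, ridge (hermiteC n) e x * gaussExpL2 c η x ∂(gaussianRd d) =
      ∫ x, ridge (hermiteC n) e x * gaussExp c η x ∂(gaussianRd d) :=
    integral_congr_ae ((coeFn_gaussExpL2 c η).mono fun x hx => by simp only [hx])
  rw [h]
  rcases he with he | rfl
  · exact integral_ridge_hermiteC_mul_gaussExp he c η
  · simpa [hermiteC_zero, ridge] using integral_gaussExp c η

/-- The action of `exp(-zL)` on exponentials. -/
lemma IsExpNegOU.apply_gaussExpL2 {z : ℂ} (hz : 0 < z.re) {V : GaussL2 d →L[ℂ] GaussL2 d}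
    (hV : IsExpNegOU z V) (c : ℂ) (η : 𝔼) :
    V (gaussExpL2 c η) = gaussExpL2 (Complex.exp (-z) * c) η := by
  obtain ⟨ι, deg, b, hb⟩ := exists_hermiteBasis d
  rw [hV.eq_expSemigroup hb hz]
  refine b.ext_repr fun i => ?_
  rw [b.repr_expSemigroup _ _ z hz zero_le_one, b.repr_apply_apply, b.repr_apply_apply]
  -- By homogeneity, replacing `c` by `exp(-z) c` multiplies the pairings with degree `n` by
  -- `exp(-z) ^ n`, which is the multiplier of the semigroup.
  have h : hermiteSpace d (deg i) ≤ (Submodule.span ℂ {gaussExpL2 (Complex.exp (-z) * c) η -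
      (Complex.exp (-z)) ^ deg i • gaussExpL2 c η})ᗮ := by
    refine hermiteSpace_le (Submodule.isClosed_orthogonal _) fun e he => ?_
    rw [Submodule.mem_orthogonal_singleton_iff_inner_left, inner_sub_right, inner_smul_right,
      inner_hermiteRidge_gaussExpL2 he, inner_hermiteRidge_gaussExpL2 he, mul_assoc, mul_pow,
      sub_self]
  have h1 := h (hb i)
  rw [Submodule.mem_orthogonal_singleton_iff_inner_left, inner_sub_right, inner_smul_right,
    sub_eq_zero] at h1
  rw [h1, ← Complex.exp_nat_mul]
  congr 2
  push_cast
  ring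

end Spectral

section Mehler

/-! ### The algebra of the exponents -/

section Algebra

variable {p q u v : ℝ}

/-- The relation `h` cancels one factor `D`, so the sign of the determinant is that of a numerator
linear in `A` and `D`. In `mehler_form_pos` this numerator is exactly the quartic hypothesis. -/
lemma discriminant_eq {D A c r : ℝ} (hp : p ≠ 0) (hq : q ≠ 0) (hD : D ≠ 0)
    (h : A ^ 2 - c ^ 2 = D * (r ^ 2 - u ^ 2)) :
    (1 / q + A / D) * ((p - 1) / p + A / D) - (c / D) ^ 2 =
      ((p - 1) * D + (p * q - q + p) * A + p * q * (r ^ 2 - u ^ 2)) / (p * q * D) := by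
  field_simp
  linear_combination p * q * h

/-- The conditions on `w = u + iv` make the quadratic form of the Mehler kernel, transplanted from
`L^p(γ) → L^q(γ)` to Lebesgue spaces, positive definite. -/
lemma mehler_form_pos (hp : 1 < p) (hq : 1 < q) {r D A : ℝ} (hr : r = u ^ 2 + v ^ 2) (hr1 : r < 1)
    (hD : D = (1 + r) ^ 2 - 4 * u ^ 2) (hD0 : 0 < D) (hA : A = 2 * u ^ 2 - r - r ^ 2)
    (h₁ : r < p / q)
    (h₂ : 0 < (q - 1) * r ^ 2 + (2 - p - q) * u ^ 2 - (2 - p - q + p * q) * v ^ 2 + p - 1) :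
    0 < 1 / q + A / D ∧
      (u * (1 - r) / D) ^ 2 < (1 / q + A / D) * ((p - 1) / p + A / D) := by
  have hp0 : 0 < p := by linarith
  have hq0 : 0 < q := by linarith
  have hAc : A ^ 2 - (u * (1 - r)) ^ 2 = D * (r ^ 2 - u ^ 2) := by
    rw [hA, hD]
    ring
  have hH : 0 < (p - 1) * D + (p * q - q + p) * A + p * q * (r ^ 2 - u ^ 2) := by
    have hv : v ^ 2 = r - u ^ 2 := by linarith
    rw [hv] at h₂
    refine h₂.trans_eq ?_
    rw [hA, hD]
    ring
  have hdisc : (u * (1 - r) / D) ^ 2 < (1 / q + A / D) * ((p - 1) / p + A / D) := by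
    rw [← sub_pos, discriminant_eq hp0.ne' hq0.ne' hD0.ne' hAc]
    positivity
  -- Since the determinant is positive, failure makes both diagonal entries negative. Splitting the
  -- numerator `hH` in two ways then gives `h1` and `h2`.
  have hX : 0 < 1 / q + A / D := by
    by_contra! hX
    have hXY : 0 < (1 / q + A / D) * ((p - 1) / p + A / D) := (sq_nonneg _).trans_lt hdisc
    have hY : (p - 1) / p + A / D < 0 := by
      by_contra! hY
      exact absurd (mul_nonpos_of_nonpos_of_nonneg hX hY) (not_le.2 hXY)
    have hX' : D + q * A ≤ 0 := by
      have : D + q * A = q * D * (1 / q + A / D) := by field_simp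
      rw [this]
      exact mul_nonpos_of_nonneg_of_nonpos (by positivity) hX
    have hY' : (p - 1) * D + p * A ≤ 0 := by
      have : (p - 1) * D + p * A = p * D * ((p - 1) / p + A / D) := by field_simp
      rw [this]
      exact mul_nonpos_of_nonneg_of_nonpos (by positivity) hY.le
    have h1 : 0 < A + q * (r ^ 2 - u ^ 2) := by
      have h3 : 0 < p * (A + q * (r ^ 2 - u ^ 2)) := by
        have := mul_nonpos_of_nonneg_of_nonpos (sub_pos.2 hp).le hX'
        linarith
      exact pos_of_mul_pos_right h3 hp0.le
    have h2 : 0 < (p - 1) * A + p * (r ^ 2 - u ^ 2) := by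
      have h3 : 0 < q * ((p - 1) * A + p * (r ^ 2 - u ^ 2)) := by linarith
      exact pos_of_mul_pos_right h3 hq0.le
    have hr0 : 0 ≤ r := by rw [hr]; positivity
    have hur : u ^ 2 ≤ r := by rw [hr]; linarith [sq_nonneg v]
    have hrr : r * r ≤ r := mul_le_of_le_one_left hr0 hr1.le
    have hrq : r * q < p := (lt_div_iff₀ hq0).1 h₁
    rw [hA] at h1 h2
    rw [hA, hD] at hX' hY'
    -- From `u² ≤ r` and `r² ≤ r`, the case `q < 2` contradicts `h1` and the case `p > 2`
    -- contradicts `h2`. For `p ≤ 2 ≤ q` the signs of the diagonal entries give `p ≤ 1 + r ≤ q r`,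
    -- against `r < p / q`.
    rcases lt_or_ge q 2 with hq2 | hq2
    · have := mul_le_mul_of_nonneg_left hur (sub_pos.2 hq2).le
      have := mul_le_mul_of_nonneg_left hrr (sub_pos.2 hq).le
      linarith
    rcases lt_or_ge 2 p with hp2 | hp2
    · have := mul_le_mul_of_nonneg_left hur (sub_pos.2 hp2).le
      linarith
    · have h3 : (1 + r) * (1 + r - q * r) ≤ 0 := by
        have := mul_nonneg (sub_nonneg.2 hq2) (sq_nonneg u)
        linarith
      have h4 : (1 + r) * (p - 1 - r) ≤ 0 := by
        have := mul_nonneg (sub_nonneg.2 hp2) (sq_nonneg u)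
        linarith
      have h5 : 1 + r - q * r ≤ 0 := nonpos_of_mul_nonpos_right h3 (by linarith)
      have h6 : p - 1 - r ≤ 0 := nonpos_of_mul_nonpos_right h4 (by linarith)
      linarith
  exact ⟨hX, hdisc⟩

/-- A positive definite binary form stays positive under a small perturbation. -/
lemma exists_pos_perturbation {a b c : ℝ} (ha : 0 < a) (h : c ^ 2 < a * b) :
    ∃ ε > 0, ∀ s t m : ℝ, |m| ≤ s * t → 2 * c * m ≤ (a - ε) * s ^ 2 + (b - ε) * t ^ 2 := by
  have h1 : ∀ᶠ ε : ℝ in 𝓝 0, 0 < a - ε ∧ c ^ 2 < (a - ε) * (b - ε) := by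
    refine Eventually.and ?_ ?_
    · have : Tendsto (fun ε : ℝ => a - ε) (𝓝 0) (𝓝 (a - 0)) :=
        Continuous.tendsto (by fun_prop) 0
      exact this.eventually_const_lt (by simpa using ha)
    · have : Tendsto (fun ε : ℝ => (a - ε) * (b - ε)) (𝓝 0) (𝓝 ((a - 0) * (b - 0))) :=
        Continuous.tendsto (by fun_prop) 0
      exact this.eventually_const_lt (by simpa using h)
  obtain ⟨ε, ⟨ha', h'⟩, hε⟩ :=
    ((h1.filter_mono nhdsWithin_le_nhds).and self_mem_nhdsWithin : ∀ᶠ ε : ℝ in 𝓝[>] 0, _).exists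
  refine ⟨ε, hε, fun s t m hm => ?_⟩
  set a' := a - ε
  set b' := b - ε
  have h2 : m ^ 2 ≤ (s * t) ^ 2 := sq_le_sq' (by linarith [abs_le.1 hm]) (abs_le.1 hm).2
  have h3 : 2 * c * m ≤ 2 * |c| * (s * t) := by
    calc 2 * c * m ≤ 2 * |c * m| := by linarith [le_abs_self (c * m)]
      _ = 2 * |c| * |m| := by rw [abs_mul]; ring
      _ ≤ _ := by gcongr
  refine h3.trans ?_
  -- Completing the square after multiplication by `a' > 0`.
  have h4 : 0 ≤ a' * (a' * s ^ 2 + b' * t ^ 2 - 2 * |c| * (s * t)) := by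
    have h5 : a' * (a' * s ^ 2 + b' * t ^ 2 - 2 * |c| * (s * t)) =
        (a' * s - |c| * t) ^ 2 + (a' * b' - c ^ 2) * t ^ 2 := by
      rw [← sq_abs c]
      ring
    rw [h5]
    have := mul_nonneg (sub_pos.2 h').le (sq_nonneg t)
    positivity
  linarith [nonneg_of_mul_nonneg_right h4 ha']

end Algebra

/-! ### The Mehler kernel -/

variable {d : ℕ}

local notation "𝔼" => EuclideanSpace ℝ (Fin d)

/-- The Mehler kernel. -/
def mehler (w : ℂ) (x y : 𝔼) : ℂ :=
  ((((2 * Real.pi) ^ (-(d : ℝ) / 2) : ℝ) : ℂ) * (2 * Real.pi * (1 - w ^ 2)) ^ ((d : ℂ) / 2))⁻¹ *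
    Complex.exp (-(w ^ 2 / (1 - w ^ 2)) / 2 * (‖x‖ ^ 2 + ‖y‖ ^ 2)
      + w / (1 - w ^ 2) * (inner ℝ x y : ℝ))

/-- The linear term belongs to the complex vector `c₁v₁ + c₂v₂`, in general not a multiple of a real
one; hence coordinates, with the bilinear rather than Hermitian square. -/
lemma integral_cexp_neg_mul_norm_sq_add_add {b : ℂ} (hb : 0 < b.re) (c₁ c₂ : ℂ) (v₁ v₂ : 𝔼) :
    ∫ y : 𝔼, Complex.exp (-b * ‖y‖ ^ 2 + (c₁ * (inner ℝ v₁ y : ℝ) + c₂ * (inner ℝ v₂ y : ℝ))) =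
      (Real.pi / b) ^ ((d : ℂ) / 2) * Complex.exp ((c₁ ^ 2 * ‖v₁‖ ^ 2
        + 2 * c₁ * c₂ * (inner ℝ v₁ v₂ : ℝ) + c₂ ^ 2 * ‖v₂‖ ^ 2) / (4 * b)) := by
  have hn : ∀ y : 𝔼, (‖y‖ ^ 2 : ℂ) = ∑ i, (y i : ℂ) ^ 2 := fun y => by
    have := EuclideanSpace.real_norm_sq_eq y
    exact_mod_cast this
  have hi : ∀ x y : 𝔼, ((inner ℝ x y : ℝ) : ℂ) = ∑ i, (x i : ℂ) * y i := fun x y => by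
    rw [PiLp.inner_apply]
    simp [mul_comm]
  have h := GaussianFourier.integral_cexp_neg_mul_sum_add hb
    fun i : Fin d => c₁ * v₁ i + c₂ * v₂ i
  rw [Fintype.card_fin] at h
  rw [← (PiLp.volume_preserving_toLp (Fin d)).integral_comp
    (MeasurableEquiv.toLp 2 _).measurableEmbedding]
  have h1 : (∑ i, (c₁ * v₁ i + c₂ * v₂ i) ^ 2 : ℂ) = c₁ ^ 2 * ‖v₁‖ ^ 2
        + 2 * c₁ * c₂ * (inner ℝ v₁ v₂ : ℝ) + c₂ ^ 2 * ‖v₂‖ ^ 2 := by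
    rw [hn, hn, hi, Finset.mul_sum, Finset.mul_sum, Finset.mul_sum, ← Finset.sum_add_distrib,
      ← Finset.sum_add_distrib]
    exact Finset.sum_congr rfl fun i _ => by ring
  rw [← h1, ← h]
  refine integral_congr_ae (ae_of_all _ fun y => ?_)
  simp only [hn, hi, Finset.mul_sum, ← Finset.sum_add_distrib]
  congr 1
  exact Finset.sum_congr rfl fun i _ => by ring

lemma one_sub_sq_re_pos {w : ℂ} (hw : ‖w‖ < 1) : 0 < (1 - w ^ 2).re := by
  have h1 : (w ^ 2).re ≤ ‖w‖ ^ 2 := (Complex.re_le_norm _).trans (norm_pow w 2).le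
  have h2 : ‖w‖ ^ 2 < 1 := by nlinarith [norm_nonneg w]
  rw [Complex.sub_re, Complex.one_re]
  linarith

lemma one_sub_sq_ne_zero {w : ℂ} (hw : ‖w‖ < 1) : 1 - w ^ 2 ≠ 0 := fun h => by
  have := one_sub_sq_re_pos hw
  simp [h] at this

/-- The Mehler kernel acts on exponentials. -/
lemma integral_mehler_mul_gaussExp {w : ℂ} (hw : ‖w‖ < 1) (c : ℂ) (η x : 𝔼) :
    ∫ y, mehler w x y * gaussExp c η y ∂(gaussianRd d) = gaussExp (w * c) η x := by
  have hw0 := one_sub_sq_ne_zero hw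
  have hb : 0 < (1 / (2 * (1 - w ^ 2)) : ℂ).re := by
    have h1 := one_sub_sq_re_pos hw
    rw [one_div, mul_inv, ← Complex.ofReal_ofNat, ← Complex.ofReal_inv, Complex.re_ofReal_mul,
      Complex.inv_re]
    have := Complex.normSq_pos.2 hw0
    positivity
  have h := integral_cexp_neg_mul_norm_sq_add_add hb (w / (1 - w ^ 2)) c x η
  rw [integral_gaussianRd]
  set a : ℂ := (((2 * Real.pi) ^ (-(d : ℝ) / 2) : ℝ) : ℂ) with ha
  set k : ℂ := (2 * Real.pi * (1 - w ^ 2)) ^ ((d : ℂ) / 2) with hk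
  have ha0 : a ≠ 0 := by
    rw [ha, Complex.ofReal_ne_zero]
    positivity
  have hk0 : k ≠ 0 := by
    rw [hk, Complex.cpow_ne_zero_iff]
    left
    refine mul_ne_zero ?_ hw0
    norm_num [Real.pi_ne_zero]
  have h1 : ∀ y, (gaussDensity d y : ℂ) * (mehler w x y * gaussExp c η y) =
      (a * (a * k)⁻¹ * Complex.exp (-(w ^ 2 / (1 - w ^ 2)) / 2 * ‖x‖ ^ 2 - c ^ 2 * ‖η‖ ^ 2 / 2)) *
        Complex.exp (-(1 / (2 * (1 - w ^ 2))) * ‖y‖ ^ 2 +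
          (w / (1 - w ^ 2) * (inner ℝ x y : ℝ) + c * (inner ℝ η y : ℝ))) := fun y => by
    have h2 : (gaussDensity d y : ℂ) = a * Complex.exp (-‖y‖ ^ 2 / 2) := by
      rw [gaussDensity]
      push_cast
      rfl
    have h3 : Complex.exp (-‖y‖ ^ 2 / 2) * (Complex.exp (-(w ^ 2 / (1 - w ^ 2)) / 2 *
        (‖x‖ ^ 2 + ‖y‖ ^ 2) + w / (1 - w ^ 2) * (inner ℝ x y : ℝ)) *
          Complex.exp (c * (inner ℝ η y : ℝ) - c ^ 2 * ‖η‖ ^ 2 / 2)) =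
        Complex.exp (-(w ^ 2 / (1 - w ^ 2)) / 2 * ‖x‖ ^ 2 - c ^ 2 * ‖η‖ ^ 2 / 2) *
        Complex.exp (-(1 / (2 * (1 - w ^ 2))) * ‖y‖ ^ 2 +
          (w / (1 - w ^ 2) * (inner ℝ x y : ℝ) + c * (inner ℝ η y : ℝ))) := by
      simp only [← Complex.exp_add]
      congr 1
      field_simp
      ring
    rw [h2, mehler, gaussExp]
    linear_combination (a * (a * k)⁻¹) * h3
  simp only [h1]
  rw [integral_const_mul, h]
  -- The normalisation of `mehler` contains the same complex power as the Gaussian integral, so no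
  -- branch of the power has to be compared.
  have h4 : (Real.pi / (1 / (2 * (1 - w ^ 2))) : ℂ) ^ ((d : ℂ) / 2) = k := by
    rw [hk]
    congr 1
    field_simp
  have h5 : a * (a * k)⁻¹ * k = 1 := by field_simp
  have h6 : Complex.exp (-(w ^ 2 / (1 - w ^ 2)) / 2 * ‖x‖ ^ 2 - c ^ 2 * ‖η‖ ^ 2 / 2) *
      Complex.exp (((w / (1 - w ^ 2)) ^ 2 * ‖x‖ ^ 2 + 2 * (w / (1 - w ^ 2)) * c * (inner ℝ x η : ℝ)
        + c ^ 2 * ‖η‖ ^ 2) / (4 * (1 / (2 * (1 - w ^ 2))))) = gaussExp (w * c) η x := by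
    rw [← Complex.exp_add, gaussExp, real_inner_comm η x]
    congr 1
    field_simp
    ring
  rw [h4, ← h6]
  linear_combination (Complex.exp (-(w ^ 2 / (1 - w ^ 2)) / 2 * ‖x‖ ^ 2 - c ^ 2 * ‖η‖ ^ 2 / 2) *
      Complex.exp (((w / (1 - w ^ 2)) ^ 2 * ‖x‖ ^ 2 + 2 * (w / (1 - w ^ 2)) * c * (inner ℝ x η : ℝ)
        + c ^ 2 * ‖η‖ ^ 2) / (4 * (1 / (2 * (1 - w ^ 2)))))) * h5

lemma measurable_mehler (w : ℂ) : Measurable (Function.uncurry (mehler (d := d) w)) := by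
  refine Continuous.measurable ?_
  unfold mehler Function.uncurry
  fun_prop

/-- Only the real part of the exponent matters. With `D = |1 - w²|²`, the real parts of `w²/(1 -
w²)` and `w/(1 - w²)` are `A/D` and `Re w · (1 - |w|²)/D`, the entries of the form in
`mehler_form_pos`. -/
lemma exists_norm_mehler_le {p q : ℝ} (hp : 1 < p) (hq : 1 < q) {w : ℂ} (hw : ‖w‖ < 1)
    (h₁ : ‖w‖ ^ 2 < p / q)
    (h₂ : 0 < (q - 1) * ‖w‖ ^ 4 + (2 - p - q) * w.re ^ 2 - (2 - p - q + p * q) * w.im ^ 2 + p - 1) :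
    ∃ C : ℝ, ∃ ε > 0, ∀ x y : 𝔼, ‖mehler w x y‖ ≤
      (C * Real.exp ((1 / (2 * q) - ε) * ‖x‖ ^ 2)) *
        Real.exp (((p - 1) / (2 * p) - ε) * ‖y‖ ^ 2) := by
  have hw0 := one_sub_sq_ne_zero hw
  have hr : ‖w‖ ^ 2 = w.re ^ 2 + w.im ^ 2 := by
    rw [Complex.sq_norm, Complex.normSq_apply]
    ring
  set r := ‖w‖ ^ 2 with hrdef
  have hr1 : r < 1 := by
    have := norm_nonneg w
    rw [hrdef]
    nlinarith
  have hD : Complex.normSq (1 - w ^ 2) = (1 + r) ^ 2 - 4 * w.re ^ 2 := by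
    rw [Complex.normSq_apply, hr]
    simp [pow_two]
    ring
  set D := Complex.normSq (1 - w ^ 2) with hDdef
  have hD0 : 0 < D := Complex.normSq_pos.2 hw0
  have h4 : ‖w‖ ^ 4 = r ^ 2 := by rw [hrdef]; ring
  rw [h4] at h₂
  obtain ⟨hX, hXY⟩ := mehler_form_pos hp hq hr hr1 hD hD0 rfl h₁ h₂
  set A := 2 * w.re ^ 2 - r - r ^ 2 with hA
  have hs : (w ^ 2 / (1 - w ^ 2)).re = A / D := by
    rw [Complex.div_re, ← add_div]
    congr 1
    rw [hA, hr]
    simp [pow_two]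
    ring
  have hα : (w / (1 - w ^ 2)).re = w.re * (1 - r) / D := by
    rw [Complex.div_re, ← add_div]
    congr 1
    rw [hr]
    simp [pow_two]
    ring
  obtain ⟨ε, hε, hform⟩ := exists_pos_perturbation hX hXY
  -- The quadratic form is twice the exponent, hence `ε / 2`.
  refine ⟨‖((((2 * Real.pi) ^ (-(d : ℝ) / 2) : ℝ) : ℂ) *
    (2 * Real.pi * (1 - w ^ 2)) ^ ((d : ℂ) / 2))⁻¹‖, ε / 2, half_pos hε, fun x y => ?_⟩
  rw [mehler, norm_mul]
  refine (mul_le_mul_of_nonneg_left ?_ (norm_nonneg _)).trans_eq (mul_assoc _ _ _).symm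
  rw [← Real.exp_add, Complex.norm_exp, Real.exp_le_exp]
  have h5 : (-(w ^ 2 / (1 - w ^ 2)) / 2 * (‖x‖ ^ 2 + ‖y‖ ^ 2)
      + w / (1 - w ^ 2) * (inner ℝ x y : ℝ) : ℂ) =
      -((w ^ 2 / (1 - w ^ 2)) * (((‖x‖ ^ 2 + ‖y‖ ^ 2) / 2 : ℝ) : ℂ)) +
        w / (1 - w ^ 2) * ((inner ℝ x y : ℝ) : ℂ) := by
    push_cast
    ring
  rw [h5, Complex.add_re, Complex.neg_re, Complex.re_mul_ofReal, Complex.re_mul_ofReal, hs, hα]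
  have h6 := hform ‖x‖ ‖y‖ (inner ℝ x y) (abs_real_inner_le_norm x y)
  have h7 : 1 / (2 * q) = 1 / q / 2 := by field_simp
  have h8 : (p - 1) / (2 * p) = (p - 1) / p / 2 := by field_simp
  rw [h7, h8]
  linarith

/-- The Mehler kernel defines a bounded operator `L^p(γ) → L^q(γ)`. -/
lemma exists_mehlerOperator {p q : ℝ} (hp : 1 < p) (hq : 1 < q) {w : ℂ} (hw : ‖w‖ < 1)
    (h₁ : ‖w‖ ^ 2 < p / q)
    (h₂ : 0 < (q - 1) * ‖w‖ ^ 4 + (2 - p - q) * w.re ^ 2 - (2 - p - q + p * q) * w.im ^ 2 + p - 1)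
    {P Q : ℝ≥0∞} (hP : P = ENNReal.ofReal p) (hQ : Q = ENNReal.ofReal q) :
    ∃ T : Lp ℂ P (gaussianRd d) →ₗ[ℂ] Lp ℂ Q (gaussianRd d), (∃ C : ℝ, ∀ g, ‖T g‖ ≤ C * ‖g‖) ∧
      ∀ g, T g =ᵐ[gaussianRd d] fun x => ∫ y, mehler w x y * g y ∂(gaussianRd d) := by
  -- Free exponents `P`, `Q` allow the literal `2` to be used for `L²(γ)`.
  subst hP hQ
  obtain ⟨C, ε, hε, hb⟩ := exists_norm_mehler_le (d := d) hp hq hw h₁ h₂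
  have hp0 : 0 < p := by linarith
  have hq0 : 0 < q := by linarith
  have hp1 : 0 < p - 1 := by linarith
  have hpp : p.HolderConjugate (p / (p - 1)) := Real.HolderConjugate.conjExponent hp
  have := hpp.symm.ennrealOfReal
  -- Multiplied by `q` and by the conjugate exponent `p / (p - 1)`, the critical coefficients both
  -- become `1 / 2`, and `ε` makes the inequalities strict.
  refine exists_integralOperator (p' := ENNReal.ofReal (p / (p - 1))) (measurable_mehler w)
    (MemLp.const_mul (memLp_exp_norm_sq hq0 ?_) C) (memLp_exp_norm_sq (by positivity) ?_) hb
  · have h : (1 / (2 * q) - ε) * q = 1 / 2 - ε * q := by field_simp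
    rw [h]
    linarith [mul_pos hε hq0]
  · have h : ((p - 1) / (2 * p) - ε) * (p / (p - 1)) = 1 / 2 - ε * (p / (p - 1)) := by field_simp
    rw [h]
    have : 0 < ε * (p / (p - 1)) := by positivity
    linarith

/-! ### The main theorem -/

lemma dense_span_gaussExpL2 :
    Dense (Submodule.span ℂ (Set.range fun η : 𝔼 => gaussExpL2 Complex.I η) : Set (GaussL2 d)) := by
  rw [Submodule.dense_iff_topologicalClosure_eq_top, Submodule.topologicalClosure_eq_top_iff,
    Submodule.eq_bot_iff]
  intro f hf
  refine eq_zero_of_forall_integral_exp fun ξ => ?_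
  -- The sign compensates the conjugation in the first slot; with `c = i` the exponential is a
  -- character times `exp(|ξ|²/2)`.
  have h := (Submodule.mem_orthogonal _ _).1 hf _ (Submodule.subset_span ⟨-ξ, rfl⟩)
  rw [L2.inner_def] at h
  have h1 : ∫ x, (Real.exp (‖ξ‖ ^ 2 / 2) : ℂ) *
      (Complex.exp ((inner ℝ ξ x : ℝ) * Complex.I) * f x) ∂(gaussianRd d) = 0 := by
    rw [← h]
    refine integral_congr_ae ?_
    filter_upwards [coeFn_gaussExpL2 Complex.I (-ξ)] with x hx
    rw [hx, RCLike.inner_apply, gaussExp, ← Complex.exp_conj, ← mul_assoc, Complex.ofReal_exp,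
      ← Complex.exp_add, mul_comm (f x)]
    congr 2
    simp [Complex.conj_ofNat]
    ring
  rw [integral_const_mul] at h1
  exact (mul_eq_zero.1 h1).resolve_left (by exact_mod_cast (Real.exp_pos _).ne')

/-- The operator `exp(-zL)` is given by the Mehler kernel. -/
lemma IsExpNegOU.ae_eq_integral_mehler {z : ℂ} (hz : 0 < z.re) {V : GaussL2 d →L[ℂ] GaussL2 d}
    (hV : IsExpNegOU z V) (f : GaussL2 d) :
    V f =ᵐ[gaussianRd d]
      fun x => ∫ y, mehler (Complex.exp (-z)) x y * f y ∂(gaussianRd d) := by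
  have hw : ‖Complex.exp (-z)‖ < 1 := by
    rw [Complex.norm_exp, Real.exp_lt_one_iff, Complex.neg_re]
    linarith
  set w := Complex.exp (-z) with hwdef
  have hr : ‖w‖ ^ 2 < 1 := by nlinarith [norm_nonneg w]
  have hre : w.re ^ 2 + w.im ^ 2 = ‖w‖ ^ 2 := by
    rw [Complex.sq_norm, Complex.normSq_apply]
    ring
  -- For `p = q = 2` the hypotheses read `|w|² < 1` and `(1 - |w|²)² > 0`, so the kernel is bounded
  -- on `L²(γ)` for every `z` with `Re z > 0`.
  obtain ⟨T, ⟨C, hC⟩, hT⟩ := exists_mehlerOperator (d := d) (p := 2) (q := 2) one_lt_two one_lt_two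
    hw (by simpa using hr) (by
      have h1 : (2 - 1) * ‖w‖ ^ 4 + (2 - 2 - 2) * w.re ^ 2 - (2 - 2 - 2 + 2 * 2) * w.im ^ 2
          + 2 - 1 = (1 - ‖w‖ ^ 2) ^ 2 := by
        linear_combination (-2) * hre
      rw [h1]
      have : 0 < 1 - ‖w‖ ^ 2 := by linarith
      positivity) (P := 2) (Q := 2) (by simp) (by simp)
  have hTV : T.mkContinuous C hC = V := by
    refine ContinuousLinearMap.ext_on dense_span_gaussExpL2 ?_
    rintro _ ⟨η, rfl⟩
    rw [hV.apply_gaussExpL2 hz, LinearMap.mkContinuous_apply]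
    refine Lp.ext ((hT _).trans (EventuallyEq.trans ?_ (coeFn_gaussExpL2 _ η).symm))
    refine ae_of_all _ fun x => ?_
    rw [← integral_mehler_mul_gaussExp hw]
    exact integral_congr_ae ((coeFn_gaussExpL2 Complex.I η).mono fun y hy => by simp only [hy])
  rw [← hTV]
  exact hT f

end Mehler

end

theorem mainTheorem3 (d : ℕ) (p q : ℝ) (hp : 1 < p) (hpq : p ≤ q) (z : ℂ) (hz : 0 < z.re)
    (h₁ : ‖Complex.exp (-z)‖ ^ 2 < p / q)
    (h₂ : 0 < (q - 1) * ‖Complex.exp (-z)‖ ^ 4 + (2 - p - q) * (Complex.exp (-z)).re ^ 2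
      - (2 - p - q + p * q) * (Complex.exp (-z)).im ^ 2 + p - 1) :
    (∃! V : GaussL2 d →L[ℂ] GaussL2 d, IsExpNegOU z V) ∧
      ∀ V : GaussL2 d →L[ℂ] GaussL2 d, IsExpNegOU z V →
        ∃ T : Lp ℂ (ENNReal.ofReal p) (gaussianRd d) →ₗ[ℂ] Lp ℂ (ENNReal.ofReal q) (gaussianRd d),
          (∃ C : ℝ, ∀ g, ‖T g‖ ≤ C * ‖g‖) ∧
            ∀ (f : GaussL2 d) (g : Lp ℂ (ENNReal.ofReal p) (gaussianRd d)),
              f =ᵐ[gaussianRd d] g → T g =ᵐ[gaussianRd d] V f := by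
  refine ⟨existsUnique_isExpNegOU d hz, fun V hV => ?_⟩
  have hw : ‖Complex.exp (-z)‖ < 1 := by
    rw [Complex.norm_exp, Real.exp_lt_one_iff, Complex.neg_re]
    linarith
  -- `T` and `V` are given by one and the same kernel integral, which depends only on the almost
  -- everywhere class of the function.
  obtain ⟨T, hC, hT⟩ := exists_mehlerOperator (d := d) hp (hp.trans_le hpq) hw h₁ h₂ rfl rfl
  refine ⟨T, hC, fun f g hfg => (hT g).trans (EventuallyEq.trans ?_
    (hV.ae_eq_integral_mehler hz f).symm)⟩
  refine ae_of_all _ fun x => ?_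
  exact integral_congr_ae (hfg.symm.mono fun y hy => by simp only [hy])
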